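/- **Setting.** Agents $[n]=\{1,\dots,n\}$ are split into a fixed set $\mathcal N$ of unattacked agents and the set $\mathcal A=[n]\setminus\mathcal N$ of attacked agents; $\rho=|\mathcal A|/n$. Norms are Euclidean. Assume the following. 1. For each $i\in\mathcal N$ the local objective $f_i:\mathbb R^d\to\mathbb R$ is convex, twice differentiable and $L$-smooth, i.e. $\|\nabla f_i(x)-\nabla f_i(y)\|\le L\|x-y\|$ for all $x,y$. There is a point $x^*$ that minimizes every $f_i$, $i\in\mathcal N$. The average $f=\frac1{|\mathcal N|}\sum_{i\in\mathcal N}f_i$ is $\mu$-strongly convex for some $\mu>0$: $f(y)\ge f(x)+\langle\nabla f(x),y-x\rangle+\frac\mu2\|y-x\|^2$ for all $x,y$. Put $\kappa=L/\mu$. 2. $\rho<1/(1+\kappa)$. 3. The communication graph $\mathcal G$ on $[n]$ is undirected and connected. The mixing matrix $W=(w_{ij})$ is entrywise nonnegative, real symmetric and doubly stochastic, $w_{ij}\ne0$ only if $i=j$ or $\{i,j\}$ is an edge of $\mathcal G$, and, counting eigenvalues with multiplicity, one eigenvalue of $W$ is $1$ and all the others have absolute value less than $1$. 4. At time $t=0,1,2,\dots$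 the gradient oracle of agent $i$ returns $m_i^t$. For $i\in\mathcal N$, $m_i^t=\nabla f_i(x_i^t)+\xi_i^t$, where the noises $\xi_i^t$ ($i\in\mathcal N$, $t\ge0$) are mutually independent with $\mathbb E\,\xi_i^t=0$ and $\mathbb E\|\xi_i^t\|^2\le\sigma^2$. For $i\in\mathcal A$, $m_i^t$ is arbitrary. 5. $\eta_t=c_\eta(t+\varphi)^{-\tau_\eta}$, $\gamma_t=c_\gamma(t+\varphi)^{-\tau_\gamma}$, $\alpha_t=c_\alpha(t+\varphi)^{-\tau_\alpha}$, all in $(0,1)$ for every $t\ge 0$, with $c_\eta,c_\gamma,c_\alpha,\tau_\eta,\tau_\gamma,\tau_\alpha>0$ and a positive integer $\varphi$, and $$\tau_\eta=\tfrac23(\tau_\alpha+\tau_\gamma),\qquad 2\tau_\gamma<\tau_\alpha<\min(1,\,1-\tau_\gamma).$$ **CLIP-VRG.** All agents start from a common point, $x_i^0=x_j^0$ for all $i,j$, and every agent $i\in[n]$ (attacked or not) computes, for $t\ge0$, $$v_i^0=m_i^0,\qquad v_i^{t+1}=(1-\eta_t)v_i^t+\eta_t m_i^{t+1},\qquad x_i^{t+1}=\sum_{j=1}^n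 w_{ij}\bigl(x_j^t-\alpha_t k_j^t v_j^t\bigr),$$ where $k_i^t=1$ if $\|v_i^t\|\le\gamma_t$ and $k_i^t=\gamma_t\|v_i^t\|^{-1}$ otherwise. **Theorem.** Then for every agent $i\in[n]$ and every $0<\tau<\min\bigl(\tau_\gamma,(\tau_\alpha-2\tau_\gamma)/3\bigr)$, $$\mathbb P\Bigl(\lim_{t\to\infty}(t+1)^\tau\|x_i^t-x^*\|=0\Bigr)=1.$$ -/

import Mathlib

open MeasureTheory ProbabilityTheory Filter Topology

noncomputable section

namespace ClipVRG

/-- A decision variable: a vector of `ℝ^d` with the Euclidean norm. -/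
abbrev Vec (d : ℕ) : Type := EuclideanSpace ℝ (Fin d)

/-! ### Objectives -/

/-- `g` is `L`-smooth: its gradient is `L`-Lipschitz (stated for differentiable `g`). -/
def IsSmooth {d : ℕ} (L : ℝ) (g : Vec d → ℝ) : Prop :=
  ∀ x y : Vec d, ‖gradient g x - gradient g y‖ ≤ L * ‖x - y‖

/-- `g` is twice (Fréchet) differentiable on `ℝ^d`. -/
def TwiceDifferentiable {d : ℕ} (g : Vec d → ℝ) : Prop :=
  Differentiable ℝ g ∧ Differentiable ℝ (gradient g)

/-- `g` is `μ`-strongly convex (first-order form, for differentiable `g`). -/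
def IsStronglyConvex {d : ℕ} (μ : ℝ) (g : Vec d → ℝ) : Prop :=
  ∀ x y : Vec d,
    g x + inner ℝ (gradient g x) (y - x) + μ / 2 * ‖y - x‖ ^ 2 ≤ g y

/-- The average `f = (1/|N|) ∑_{i ∈ N} f_i` of the objectives of the unattacked agents. -/
def avgObjective {n d : ℕ} (N : Finset (Fin n)) (f : Fin n → Vec d → ℝ) (x : Vec d) : ℝ :=
  (1 / (N.card : ℝ)) * ∑ i ∈ N, f i x

/-- The fraction `ρ = |A| / n` of attacked agents, where `A` is the complement of the set `N`
of unattacked agents. -/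
def attackedFraction {n : ℕ} (N : Finset (Fin n)) : ℝ :=
  ((Nᶜ : Finset (Fin n)).card : ℝ) / (n : ℝ)

/-! ### The network -/

/-- `W` is an admissible mixing matrix for the communication graph `G`: it is supported on the
edges of `G` and the diagonal, real symmetric, doubly stochastic (entrywise nonnegative with all
row and column sums `1`), and, counting its eigenvalues with multiplicity, one of them equals `1`
and all the others have absolute value `< 1`. -/
structure IsMixingMatrix {n : ℕ} (G : SimpleGraph (Fin n)) (W : Matrix (Fin n) (Fin n) ℝ) :
    Prop where
  support : ∀ i j, W i j ≠ 0 → G.Adj i j ∨ i = j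
  symmetric : W.IsHermitian
  stochastic : W ∈ doublyStochastic ℝ (Fin n)
  spectral_gap : ∃ i₀ : Fin n, symmetric.eigenvalues i₀ = 1 ∧
    ∀ i : Fin n, i ≠ i₀ → |symmetric.eigenvalues i| < 1

/-! ### The algorithm -/

/-- The polynomially decaying sequence `c (t + φ)^(-τ)`. -/
def schedule (c : ℝ) (φ : ℕ) (τ : ℝ) (t : ℕ) : ℝ :=
  c * ((t : ℝ) + (φ : ℝ)) ^ (-τ)

/-- The clipping coefficient `k` of the vector `v` at threshold `γ`. -/
def clipCoeff {d : ℕ} (γ : ℝ) (v : Vec d) : ℝ :=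
  if ‖v‖ ≤ γ then 1 else γ * ‖v‖⁻¹

/-- `x i t` and `v i t` are the iterates and gradient estimators (agent `i`, time `t`) of a run of
CLIP-VRG with mixing matrix `W`, stepsizes `α`, clipping thresholds `γ`, averaging weights `η`,
when the gradient oracle of agent `i` returns `m i t` at time `t`. -/
structure IsRun {n d : ℕ} (W : Matrix (Fin n) (Fin n) ℝ) (α γ η : ℕ → ℝ)
    (m x v : Fin n → ℕ → Vec d) : Prop where
  init_eq : ∀ i j, x i 0 = x j 0
  v_zero : ∀ i, v i 0 = m i 0
  v_succ : ∀ i t, v i (t + 1) = (1 - η t) • v i t + η t • m i (t + 1)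
  x_succ : ∀ i t, x i (t + 1) =
    ∑ j, W i j • (x j t - (α t * clipCoeff (γ t) (v j t)) • v j t)

/-- The gradient noise `ξ i t` of the unattacked agents `i ∈ N`: mutually independent over all
`i ∈ N` and all times `t`, with mean zero and second moment at most `σ²`. -/
structure IsNoise {n d : ℕ} {Ω : Type*} [MeasurableSpace Ω] (P : Measure Ω)
    (N : Finset (Fin n)) (σ : ℝ) (ξ : Fin n → ℕ → Ω → Vec d) : Prop where
  memLp : ∀ i ∈ N, ∀ t, MemLp (ξ i t) 2 P
  indep : iIndepFun (fun (p : {i : Fin n // i ∈ N} × ℕ) => ξ p.1.1 p.2) P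
  mean_zero : ∀ i ∈ N, ∀ t, ∫ ω, ξ i t ω ∂P = 0
  second_moment : ∀ i ∈ N, ∀ t, ∫ ω, ‖ξ i t ω‖ ^ 2 ∂P ≤ σ ^ 2

end ClipVRG

end

/-! Almost surely, a pathwise argument on the average iterate `x̄` works. Mixing preserves averages,
so `x̄` moves by `-α` times the mean of the clipped estimators, a step of length at most `α γ`. The
spectral gap keeps every agent within `O(α γ)` of `x̄`.

Put `r = ‖x̄ - x*‖` and suppose `r ≥ γ / L`. An unattacked gradient at `x̄` has norm at most `L r`,
so clipping shrinks it by a factor no smaller than `γ / (L r)`. By strong convexity the unattacked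
agents together push towards `x*` with strength at least `|N| (μ / L) γ`. The attacked agents, being
clipped, push back with at most `|A| γ`. The bound on `ρ` says exactly that the net drift is
positive, so without errors `r` drops by a multiple of `α γ` at each step.

There are two errors. The moving average of past gradients lags by `O(α γ / η)`, which is `o(γ)`
because `τη < τα`. The moving average `z` of the noise is not shown to be small compared with `γ` at
every time. Only its clipped effect matters, and that is controlled by the saturated energy `q / (1
+ q)`, `q = (‖z‖ / γ) ^ 2`. With `a = η q / (1 + q) - e` and `e` the drift correction, `exp (∑ a) (1
+ q)` is a supermartingale. Summing over all starting times gives `growth a t`, whose mean is `O(t ^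
2)`. Its logarithm `H` is therefore nonnegative, has increments at least `a`, and is almost surely
at most `4 log (t + 1)` from some time on.

Hence `r` decreases by a multiple of `α γ` up to `K b (H (t + 1) - H t)` with `b = α γ / η`. Since
`b` varies slowly, `r - K b H` is a Lyapunov function above the level `γ / L`. As `∑ α γ = ∞`, it
reaches a barrier `M γ` and stays below it, so `r ≤ M γ + O(b log t)`, and `b log t = o(γ)`. -/

noncomputable section

namespace ClipVRG

/-! ### Averaged noise: exponential supermartingale and logarithmic potential -/

/-- The exponential moving average of `w` with weights `η`. -/
def ema {E : Type*} [AddCommGroup E] [Module ℝ E] (η : ℕ → ℝ) (w : ℕ → E) : ℕ → E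
  | 0 => w 0
  | t + 1 => (1 - η t) • ema η w t + η t • w (t + 1)

/-- The recursion `g 0 = 1`, `g (t + 1) = 1 + exp (a t) * g t`. -/
def growth (a : ℕ → ℝ) : ℕ → ℝ
  | 0 => 1
  | t + 1 => 1 + growth a t * Real.exp (a t)

lemma one_le_growth (a : ℕ → ℝ) (t : ℕ) : 1 ≤ growth a t := by
  induction t with
  | zero => simp [growth]
  | succ t ih =>
    have : 0 ≤ growth a t * Real.exp (a t) := by positivity
    simp only [growth]; linarith

lemma growth_mono {a b : ℕ → ℝ} (h : ∀ t, a t ≤ b t) (t : ℕ) : growth a t ≤ growth b t := by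
  induction t with
  | zero => simp [growth]
  | succ t ih =>
    have := one_le_growth a t
    have := one_le_growth b t
    simp only [growth]
    gcongr
    exact h t

/-- Unrolled, `growth a t` is the sum over starting times `s ≤ t` of `exp (a s + ... + a (t - 1))`.
The summand 1 added at each step keeps the logarithm nonnegative, and discarding it gives the
increment bound, so the logarithm can serve as a potential. -/
lemma log_growth_succ (a : ℕ → ℝ) (t : ℕ) :
    Real.log (growth a t) + a t ≤ Real.log (growth a (t + 1)) := by
  have h := one_le_growth a t
  calc Real.log (growth a t) + a t = Real.log (growth a t * Real.exp (a t)) := by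
        rw [Real.log_mul (by positivity) (Real.exp_pos _).ne', Real.log_exp]
    _ ≤ _ := by
        apply Real.log_le_log (by positivity)
        simp only [growth]; linarith

/-- One step of the exponential supermartingale for the squared ratio `q = (‖z‖ / γ) ^ 2`. -/
lemma one_add_ratio_step {η g s q : ℝ} (hη0 : 0 ≤ η) (hη1 : η ≤ 1) (hg : 0 ≤ g) (hs : 0 ≤ s)
    (hq : 0 ≤ q) :
    Real.exp (η * (q / (1 + q)) - (g + s)) * (1 + (1 - η) ^ 2 * ((1 + g) * q) + s) ≤ 1 + q := by
  have h1 : 1 + (1 - η) ^ 2 * ((1 + g) * q) + s ≤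
      (1 + q) * Real.exp (-(η * (q / (1 + q)) - (g + s))) := by
    have hexp := Real.add_one_le_exp (-(η * (q / (1 + q)) - (g + s)))
    have h2 := mul_le_mul_of_nonneg_left hexp (by linarith : 0 ≤ 1 + q)
    refine le_trans ?_ h2
    have h3 : (1 + q) * (-(η * (q / (1 + q)) - (g + s)) + 1) =
        1 + q - η * q + (g + s) * (1 + q) := by field_simp; ring
    rw [h3]
    -- Only one factor `1 - η` is needed: the loss `η q` is what the exponent `η q / (1 + q)`
    -- consumes after multiplication by `1 + q`.
    have h4 : (1 - η) ^ 2 ≤ 1 - η := by nlinarith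
    have h5 := mul_le_mul_of_nonneg_right h4 (by positivity : 0 ≤ (1 + g) * q)
    nlinarith [mul_nonneg hs hq, mul_nonneg hη0 (mul_nonneg hg hq)]
  calc _ ≤ Real.exp (η * (q / (1 + q)) - (g + s)) *
        ((1 + q) * Real.exp (-(η * (q / (1 + q)) - (g + s)))) := by gcongr
    _ = 1 + q := by rw [Real.exp_neg]; field_simp

/-- The correction term which makes the exponential of the clipped noise a supermartingale. -/
def driftCorrection (η γ : ℕ → ℝ) (σ : ℝ) (t : ℕ) : ℝ :=
  ((γ t) ^ 2 / (γ (t + 1)) ^ 2 - 1) + (η t) ^ 2 * σ ^ 2 / (γ (t + 1)) ^ 2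

/-- The increment `η q / (1 + q) - e` with `q = (‖z‖ / γ) ^ 2`. -/
def noiseIncrement {E : Type*} [NormedAddCommGroup E] (η γ : ℕ → ℝ) (σ : ℝ) (z : ℕ → E)
    (t : ℕ) : ℝ :=
  η t * ((‖z t‖ / γ t) ^ 2 / (1 + (‖z t‖ / γ t) ^ 2)) - driftCorrection η γ σ t

lemma driftCorrection_nonneg {η γ : ℕ → ℝ} {σ : ℝ} (hγ : ∀ t, 0 < γ t)
    (hanti : ∀ t, γ (t + 1) ≤ γ t) (t : ℕ) :
    0 ≤ driftCorrection η γ σ t := by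
  have h1 : 1 ≤ (γ t) ^ 2 / (γ (t + 1)) ^ 2 := by
    rw [one_le_div (pow_pos (hγ _) 2)]
    exact pow_le_pow_left₀ (hγ _).le (hanti t) 2
  have h2 : 0 ≤ (η t) ^ 2 * σ ^ 2 / (γ (t + 1)) ^ 2 := by positivity
  unfold driftCorrection; linarith

/-- This deterministic bound makes the exponential weights bounded at each time, so second moments
of the noise suffice for integrability. -/
lemma noiseIncrement_le_one {E : Type*} [NormedAddCommGroup E]
    {η γ : ℕ → ℝ} {σ : ℝ} (hη : ∀ t, η t ∈ Set.Ioo (0 : ℝ) 1) (hγ : ∀ t, 0 < γ t)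
    (hanti : ∀ t, γ (t + 1) ≤ γ t) (z : ℕ → E) (t : ℕ) : noiseIncrement η γ σ z t ≤ 1 := by
  have h1 := driftCorrection_nonneg (η := η) (σ := σ) hγ hanti t
  have h2 : (‖z t‖ / γ t) ^ 2 / (1 + (‖z t‖ / γ t) ^ 2) ≤ 1 := by
    rw [div_le_one (by positivity)]; linarith
  have h3 : η t * ((‖z t‖ / γ t) ^ 2 / (1 + (‖z t‖ / γ t) ^ 2)) ≤ 1 * 1 := by
    have := hη t
    exact mul_le_mul this.2.le h2 (by positivity) zero_le_one
  unfold noiseIncrement; linarith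

lemma memLp_ema {E : Type*} [NormedAddCommGroup E] [InnerProductSpace ℝ E] {Ω : Type*}
    [MeasurableSpace Ω] {P : Measure Ω} {η : ℕ → ℝ} {ξ : ℕ → Ω → E}
    (hξ : ∀ t, MemLp (ξ t) 2 P) (t : ℕ) :
    MemLp (fun ω => ema η (fun s => ξ s ω) t) 2 P := by
  induction t with
  | zero => exact hξ 0
  | succ t ih => exact (ih.const_smul (1 - η t)).add ((hξ (t + 1)).const_smul (η t))

section Noise

variable {E : Type*} [NormedAddCommGroup E] [InnerProductSpace ℝ E] [MeasurableSpace E]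
  [BorelSpace E]

variable {Ω : Type*} [m0 : MeasurableSpace Ω] {P : Measure Ω}
  {η γ : ℕ → ℝ} {σ : ℝ} {ξ : ℕ → Ω → E}

lemma stronglyMeasurable_ema (hm : ∀ t, StronglyMeasurable (ξ t)) (t : ℕ) :
    StronglyMeasurable[Filtration.natural ξ hm t] fun ω => ema η (fun s => ξ s ω) t := by
  induction t with
  | zero => exact Filtration.stronglyAdapted_natural hm 0
  | succ t ih =>
    have h1 := Filtration.stronglyAdapted_natural hm (t + 1)
    have h2 := ih.mono ((Filtration.natural ξ hm).mono (Nat.le_succ t))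
    exact (h2.const_smul (1 - η t)).add (h1.const_smul (η t))

lemma stronglyMeasurable_noiseIncrement (hm : ∀ t, StronglyMeasurable (ξ t)) (t : ℕ) :
    StronglyMeasurable[Filtration.natural ξ hm t]
      fun ω => noiseIncrement η γ σ (ema η fun s => ξ s ω) t := by
  have h : Measurable[Filtration.natural ξ hm t] fun ω => ‖ema η (fun s => ξ s ω) t‖ :=
    measurable_norm.comp (stronglyMeasurable_ema hm t).measurable
  refine Measurable.stronglyMeasurable ?_
  have h2 := (h.div_const (γ t)).pow_const 2
  exact ((h2.div (h2.const_add 1)).const_mul (η t)).sub_const _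

lemma stronglyMeasurable_growth (hm : ∀ t, StronglyMeasurable (ξ t)) (t : ℕ) :
    StronglyMeasurable[Filtration.natural ξ hm t]
      fun ω => growth (noiseIncrement η γ σ (ema η fun s => ξ s ω)) t := by
  induction t with
  | zero => exact stronglyMeasurable_const
  | succ t ih =>
    have h2 := ih.mono ((Filtration.natural ξ hm).mono (Nat.le_succ t))
    have h3 := (stronglyMeasurable_noiseIncrement (η := η) (γ := γ) (σ := σ) hm t).mono
      ((Filtration.natural ξ hm).mono (Nat.le_succ t))
    exact ((h2.measurable.mul h3.measurable.exp).const_add 1).stronglyMeasurable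

/-- Second moment of an independent, centred perturbation, weighted by a bounded factor. -/
lemma integral_mul_norm_add_sq_le [CompleteSpace E] {Ω : Type*} {m m0 : MeasurableSpace Ω}
    {P : Measure Ω}
    [IsProbabilityMeasure P] (hm : m ≤ m0) {F : Ω → ℝ} {z ξ : Ω → E}
    (hind : Indep (MeasurableSpace.comap ξ inferInstance) m P)
    (hFm : StronglyMeasurable[m] F) (hzm : StronglyMeasurable[m] z)
    {B : ℝ} (hF0 : ∀ ω, 0 ≤ F ω) (hFB : ∀ ω, F ω ≤ B)
    (hz : MemLp z 2 P) (hξ : MemLp ξ 2 P) (hmean : ∫ ω, ξ ω ∂P = 0) {σ : ℝ}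
    (hσ : ∫ ω, ‖ξ ω‖ ^ 2 ∂P ≤ σ ^ 2) (a b : ℝ) :
    Integrable (fun ω => F ω * ‖a • z ω + b • ξ ω‖ ^ 2) P ∧
    ∫ ω, F ω * ‖a • z ω + b • ξ ω‖ ^ 2 ∂P ≤
      ∫ ω, F ω * (a ^ 2 * ‖z ω‖ ^ 2 + b ^ 2 * σ ^ 2) ∂P := by
  have hFm' : AEStronglyMeasurable F P := (hFm.mono hm).aestronglyMeasurable
  have hbd : ∀ᵐ ω ∂P, ‖F ω‖ ≤ B := .of_forall fun ω => by
    rw [Real.norm_eq_abs, abs_of_nonneg (hF0 ω)]; exact hFB ω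
  have hFint : Integrable F P := .of_bound hFm' B hbd
  have hz2 : Integrable (fun ω => ‖z ω‖ ^ 2) P := hz.integrable_norm_pow (by norm_num)
  have hξ2 : Integrable (fun ω => ‖ξ ω‖ ^ 2) P := hξ.integrable_norm_pow (by norm_num)
  have hzi : Integrable z P := hz.integrable (by norm_num)
  have hξi : Integrable ξ P := hξ.integrable (by norm_num)
  have hFz2 : Integrable (fun ω => F ω * ‖z ω‖ ^ 2) P := hz2.bdd_mul hFm' hbd
  have hFξ2 : Integrable (fun ω => F ω * ‖ξ ω‖ ^ 2) P := hξ2.bdd_mul hFm' hbd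
  have hFz : Integrable (fun ω => F ω • z ω) P := hzi.bdd_smul B hFm' hbd
  have hcross : IndepFun (fun ω => F ω • z ω) ξ P := by
    rw [IndepFun_iff_Indep]
    refine indep_of_indep_of_le_left hind.symm ?_
    exact (hFm.smul hzm).measurable.comap_le
  have hcross0 : ∫ ω, inner ℝ (F ω • z ω) (ξ ω) ∂P = 0 := by
    have : ∫ ω, inner ℝ (F ω • z ω) (ξ ω) ∂P = innerSL ℝ (∫ ω, F ω • z ω ∂P) (∫ ω, ξ ω ∂P) :=
      hcross.integral_bilin hFz hξi (innerSL ℝ)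
    rw [this, hmean, map_zero]
  have hcrossi : Integrable (fun ω => inner ℝ (F ω • z ω) (ξ ω)) P :=
    hcross.integrable_bilin hFz hξi (innerSL ℝ)
  have hFind : IndepFun F (fun ω => ‖ξ ω‖ ^ 2) P := by
    rw [IndepFun_iff_Indep]
    refine indep_of_indep_of_le hind.symm hFm.measurable.comap_le ?_
    have : Measurable[MeasurableSpace.comap ξ inferInstance] fun ω => ‖ξ ω‖ ^ 2 :=
      ((measurable_norm.pow_const 2).comp (comap_measurable ξ))
    exact this.comap_le
  have hFξ : ∫ ω, F ω * ‖ξ ω‖ ^ 2 ∂P = (∫ ω, F ω ∂P) * ∫ ω, ‖ξ ω‖ ^ 2 ∂P :=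
    hFind.integral_fun_mul_eq_mul_integral hFm' hξ2.aestronglyMeasurable
  have hexp : ∀ ω, F ω * ‖a • z ω + b • ξ ω‖ ^ 2 = a ^ 2 * (F ω * ‖z ω‖ ^ 2)
      + 2 * a * b * inner ℝ (F ω • z ω) (ξ ω) + b ^ 2 * (F ω * ‖ξ ω‖ ^ 2) := fun ω => by
    rw [norm_add_sq_real, norm_smul, norm_smul, inner_smul_left, inner_smul_right,
      inner_smul_left, mul_pow, mul_pow, Real.norm_eq_abs, Real.norm_eq_abs, sq_abs, sq_abs]
    simp only [conj_trivial]
    ring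
  have h1 := hFz2.const_mul (a ^ 2)
  have h2 := hcrossi.const_mul (2 * a * b)
  have h3 := hFξ2.const_mul (b ^ 2)
  have h12 : Integrable (fun ω => a ^ 2 * (F ω * ‖z ω‖ ^ 2)
      + 2 * a * b * inner ℝ (F ω • z ω) (ξ ω)) P := h1.add h2
  refine ⟨by simp_rw [hexp]; exact h12.add h3, ?_⟩
  have hr : ∫ ω, F ω * (a ^ 2 * ‖z ω‖ ^ 2 + b ^ 2 * σ ^ 2) ∂P =
      a ^ 2 * ∫ ω, F ω * ‖z ω‖ ^ 2 ∂P + b ^ 2 * σ ^ 2 * ∫ ω, F ω ∂P := by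
    rw [← integral_const_mul, ← integral_const_mul,
      ← integral_add h1 (hFint.const_mul _)]
    congr 1; ext ω; ring
  rw [hr]
  simp_rw [hexp]
  rw [integral_add h12 h3, integral_add h1 h2, integral_const_mul, integral_const_mul,
    integral_const_mul, hcross0, hFξ]
  have hF0' : 0 ≤ ∫ ω, F ω ∂P := integral_nonneg hF0
  have := mul_le_mul_of_nonneg_left (mul_le_mul_of_nonneg_left hσ hF0') (sq_nonneg b)
  nlinarith

variable [CompleteSpace E] [IsProbabilityMeasure P]

/-- Independence removes the cross term, and `(1 - η) ^ 2 + η ^ 2 ≤ 1` preserves the bound `σ ^ 2`.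
-/
lemma integral_norm_ema_sq_le (hη : ∀ t, η t ∈ Set.Ioo (0 : ℝ) 1)
    (hm : ∀ t, StronglyMeasurable (ξ t))
    (hind : iIndepFun ξ P) (hξ : ∀ t, MemLp (ξ t) 2 P) (hmean : ∀ t, ∫ ω, ξ t ω ∂P = 0)
    (hσ : ∀ t, ∫ ω, ‖ξ t ω‖ ^ 2 ∂P ≤ σ ^ 2) (t : ℕ) :
    ∫ ω, ‖ema η (fun s => ξ s ω) t‖ ^ 2 ∂P ≤ σ ^ 2 := by
  induction t with
  | zero => exact hσ 0
  | succ t ih =>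
    have h := (integral_mul_norm_add_sq_le (F := fun _ => 1) (B := 1)
      ((Filtration.natural ξ hm).le t) (hind.indep_comap_natural_of_lt hm (Nat.lt_succ_self t))
      stronglyMeasurable_const (stronglyMeasurable_ema (η := η) hm t) (fun _ => zero_le_one)
      (fun _ => le_rfl) (memLp_ema hξ t) (hξ (t + 1)) (hmean (t + 1)) (hσ (t + 1))
      (1 - η t) (η t)).2
    simp only [one_mul] at h
    refine h.trans ?_
    have hz2 : Integrable (fun ω => ‖ema η (fun s => ξ s ω) t‖ ^ 2) P :=
      (memLp_ema hξ t).integrable_norm_pow (by norm_num)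
    rw [integral_add (hz2.const_mul _) (integrable_const _), integral_const_mul]
    simp only [integral_const, probReal_univ, one_smul]
    have := mul_le_mul_of_nonneg_left ih (sq_nonneg (1 - η t))
    have := hη t
    nlinarith [sq_nonneg σ, mul_nonneg (mul_nonneg this.1.le (sub_nonneg.2 this.2.le))
      (sq_nonneg σ)]

/-- Each exponential in the unrolled sum, multiplied by `1 + q`, is a supermartingale from its
starting time `s`, where its mean is at most `1 + σ ^ 2 / (γ s) ^ 2`. -/
lemma integral_growth_le (hη : ∀ t, η t ∈ Set.Ioo (0 : ℝ) 1) (hγ : ∀ t, 0 < γ t)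
    (hanti : ∀ t, γ (t + 1) ≤ γ t) (hm : ∀ t, StronglyMeasurable (ξ t))
    (hind : iIndepFun ξ P) (hξ : ∀ t, MemLp (ξ t) 2 P) (hmean : ∀ t, ∫ ω, ξ t ω ∂P = 0)
    (hσ : ∀ t, ∫ ω, ‖ξ t ω‖ ^ 2 ∂P ≤ σ ^ 2) (t : ℕ) :
    Integrable (fun ω => growth (noiseIncrement η γ σ (ema η fun s => ξ s ω)) t *
      (1 + (‖ema η (fun s => ξ s ω) t‖ / γ t) ^ 2)) P ∧
    ∫ ω, growth (noiseIncrement η γ σ (ema η fun s => ξ s ω)) t *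
      (1 + (‖ema η (fun s => ξ s ω) t‖ / γ t) ^ 2) ∂P ≤
      ∑ s ∈ Finset.range (t + 1), (1 + σ ^ 2 / (γ s) ^ 2) := by
  have hratio : ∀ s, Integrable (fun ω => 1 + (‖ema η (fun s => ξ s ω) s‖ / γ s) ^ 2) P ∧
      ∫ ω, (1 + (‖ema η (fun s => ξ s ω) s‖ / γ s) ^ 2) ∂P ≤ 1 + σ ^ 2 / (γ s) ^ 2 := by
    intro s
    have hz2 : Integrable (fun ω => ‖ema η (fun s => ξ s ω) s‖ ^ 2) P :=
      (memLp_ema hξ s).integrable_norm_pow (by norm_num)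
    simp_rw [div_pow]
    refine ⟨(integrable_const _).add (hz2.div_const _), ?_⟩
    rw [integral_add (integrable_const _) (hz2.div_const _), integral_div]
    simp only [integral_const, probReal_univ, one_smul]
    gcongr
    exact integral_norm_ema_sq_le hη hm hind hξ hmean hσ s
  induction t with
  | zero =>
    simpa [growth] using hratio 0
  | succ t ih =>
    set z : ℕ → Ω → E := fun t ω => ema η (fun s => ξ s ω) t with hz
    set a : ℕ → Ω → ℝ := fun t ω => noiseIncrement η γ σ (ema η fun s => ξ s ω) t with ha
    set F : Ω → ℝ := fun ω => growth (noiseIncrement η γ σ (ema η fun s => ξ s ω)) t *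
      Real.exp (a t ω) with hF
    have hF0 : ∀ ω, 0 ≤ F ω := fun ω =>
      mul_nonneg (zero_le_one.trans (one_le_growth _ _)) (Real.exp_pos _).le
    have hFB : ∀ ω, F ω ≤ growth (fun _ => 1) t * Real.exp 1 := fun ω =>
      mul_le_mul (growth_mono (noiseIncrement_le_one hη hγ hanti _) t)
        (Real.exp_le_exp.2 (noiseIncrement_le_one hη hγ hanti _ t)) (Real.exp_pos _).le
        (zero_le_one.trans (one_le_growth _ _))
    have hFm : StronglyMeasurable[Filtration.natural ξ hm t] F :=
      ((stronglyMeasurable_growth hm t).measurable.mul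
        (stronglyMeasurable_noiseIncrement hm t).measurable.exp).stronglyMeasurable
    have hFm' : AEStronglyMeasurable F P :=
      (hFm.mono ((Filtration.natural ξ hm).le t)).aestronglyMeasurable
    have hbd : ∀ᵐ ω ∂P, ‖F ω‖ ≤ growth (fun _ => 1) t * Real.exp 1 := .of_forall fun ω => by
      rw [Real.norm_eq_abs, abs_of_nonneg (hF0 ω)]; exact hFB ω
    have hFint : Integrable F P := .of_bound hFm' _ hbd
    obtain ⟨hI, hle⟩ := integral_mul_norm_add_sq_le
      ((Filtration.natural ξ hm).le t) (hind.indep_comap_natural_of_lt hm (Nat.lt_succ_self t))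
      hFm (stronglyMeasurable_ema (η := η) hm t) hF0 hFB
      (memLp_ema hξ t) (hξ (t + 1)) (hmean (t + 1)) (hσ (t + 1)) (1 - η t) (η t)
    have hz2 : Integrable (fun ω => ‖z t ω‖ ^ 2) P :=
      (memLp_ema hξ t).integrable_norm_pow (by norm_num)
    have hI2 : Integrable (fun ω => F ω * ((1 - η t) ^ 2 * ‖z t ω‖ ^ 2 + η t ^ 2 * σ ^ 2)) P :=
      ((hz2.const_mul _).add (integrable_const _)).bdd_mul hFm' hbd
    -- The first term is the exponential started at time `t + 1`; the others continue the older ones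
    -- by one supermartingale step.
    have hsplit : ∀ ω, growth (noiseIncrement η γ σ (ema η fun s => ξ s ω)) (t + 1) *
        (1 + (‖z (t + 1) ω‖ / γ (t + 1)) ^ 2) =
        (1 + (‖z (t + 1) ω‖ / γ (t + 1)) ^ 2) +
          (F ω + (F ω * ‖(1 - η t) • z t ω + η t • ξ (t + 1) ω‖ ^ 2) / (γ (t + 1)) ^ 2) := by
      intro ω
      simp only [growth, hF, ha, hz, ema]
      ring
    have hI3 := hI.div_const ((γ (t + 1)) ^ 2)
    have hI4 : Integrable (fun ω => F ω +
      (F ω * ‖(1 - η t) • z t ω + η t • ξ (t + 1) ω‖ ^ 2) / (γ (t + 1)) ^ 2) P := hFint.add hI3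
    simp_rw [hz] at hsplit
    simp_rw [hsplit]
    refine ⟨(hratio (t + 1)).1.add hI4, ?_⟩
    rw [integral_add (hratio (t + 1)).1 hI4, integral_add hFint hI3, integral_div,
      Finset.sum_range_succ]
    have hstep : ∫ ω, F ω ∂P + (∫ ω, F ω * ‖(1 - η t) • z t ω + η t • ξ (t + 1) ω‖ ^ 2 ∂P) /
        (γ (t + 1)) ^ 2 ≤ ∑ s ∈ Finset.range (t + 1), (1 + σ ^ 2 / (γ s) ^ 2) := by
      refine le_trans ?_ ih.2
      calc _ ≤ ∫ ω, F ω ∂P + (∫ ω, F ω * ((1 - η t) ^ 2 * ‖z t ω‖ ^ 2 + η t ^ 2 * σ ^ 2) ∂P) /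
            (γ (t + 1)) ^ 2 := by gcongr
        _ = ∫ ω, (F ω + F ω * ((1 - η t) ^ 2 * ‖z t ω‖ ^ 2 + η t ^ 2 * σ ^ 2) /
            (γ (t + 1)) ^ 2) ∂P := by
          rw [integral_add hFint (hI2.div_const _), integral_div]
        _ ≤ _ := by
          refine integral_mono (hFint.add (hI2.div_const _)) ih.1 fun ω => ?_
          have hγt := hγ t
          have hγt' := hγ (t + 1)
          have hg : 0 ≤ (γ t) ^ 2 / (γ (t + 1)) ^ 2 - 1 := by
            rw [sub_nonneg, one_le_div (pow_pos hγt' 2)]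
            exact pow_le_pow_left₀ hγt'.le (hanti t) 2
          have hs : 0 ≤ (η t) ^ 2 * σ ^ 2 / (γ (t + 1)) ^ 2 := by positivity
          have key := one_add_ratio_step (hη t).1.le (hη t).2.le hg hs
            (sq_nonneg (‖z t ω‖ / γ t))
          have hG : 0 ≤ growth (noiseIncrement η γ σ (ema η fun s => ξ s ω)) t :=
            zero_le_one.trans (one_le_growth _ _)
          have := mul_le_mul_of_nonneg_left key hG
          refine le_trans (le_of_eq ?_) this
          simp only [hF, ha, noiseIncrement, driftCorrection, hz]
          field_simp
          ring
    have := (hratio (t + 1)).2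
    linarith

/-- Almost surely, the saturated noise energy of an exponential moving average of independent
noise is dominated by the increments of a nonnegative process of logarithmic growth. -/
lemma ae_exists_potential (hη : ∀ t, η t ∈ Set.Ioo (0 : ℝ) 1) (hγ : ∀ t, 0 < γ t)
    (hanti : ∀ t, γ (t + 1) ≤ γ t) {C : ℝ} (hC : ∀ t : ℕ, 1 / (γ t) ^ 2 ≤ C * ((t : ℝ) + 1))
    (hind : iIndepFun ξ P) (hξ : ∀ t, MemLp (ξ t) 2 P) (hmean : ∀ t, ∫ ω, ξ t ω ∂P = 0)
    (hσ : ∀ t, ∫ ω, ‖ξ t ω‖ ^ 2 ∂P ≤ σ ^ 2) :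
    ∀ᵐ ω ∂P, ∃ H : ℕ → ℝ, (∀ t, 0 ≤ H t) ∧
      (∀ t, H t + noiseIncrement η γ σ (ema η fun s => ξ s ω) t ≤ H (t + 1)) ∧
      ∀ᶠ t : ℕ in atTop, H t ≤ 4 * Real.log ((t : ℝ) + 1) := by
  -- The natural filtration needs strongly measurable noise; passing to modifications changes only a
  -- null set.
  wlog hm : ∀ t, StronglyMeasurable (ξ t) generalizing ξ
  · have hae : ∀ t, ξ t =ᵐ[P] (hξ t).1.mk (ξ t) := fun t => (hξ t).1.ae_eq_mk
    have h := this (ξ := fun t => (hξ t).1.mk (ξ t)) (hind.congr hae)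
      (fun t => (memLp_congr_ae (hae t)).1 (hξ t))
      (fun t => by rw [← hmean t]; exact integral_congr_ae (hae t).symm)
      (fun t => by
        refine (le_of_eq ?_).trans (hσ t)
        refine integral_congr_ae ?_
        filter_upwards [hae t] with ω hω
        rw [hω])
      (fun t => (hξ t).1.stronglyMeasurable_mk)
    filter_upwards [h, ae_all_iff.2 hae] with ω h1 h2
    simpa only [h2] using h1
  set G : ℕ → Ω → ℝ := fun t ω => growth (noiseIncrement η γ σ (ema η fun s => ξ s ω)) t with hG
  have hG1 : ∀ t ω, 1 ≤ G t ω := fun t ω => one_le_growth _ _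
  have hGm : ∀ t, Measurable (G t) := fun t =>
    ((stronglyMeasurable_growth hm t).mono ((Filtration.natural ξ hm).le t)).measurable
  have hC0 : 0 ≤ C := by
    have := hC 0
    have h2 : 0 ≤ 1 / (γ 0) ^ 2 := by positivity
    simp only [Nat.cast_zero, zero_add, mul_one] at this
    linarith
  have hGint : ∀ t, ∫⁻ ω, ENNReal.ofReal (G t ω) ∂P ≤
      ENNReal.ofReal ((1 + σ ^ 2 * C) * ((t : ℝ) + 1) ^ 2) := by
    intro t
    obtain ⟨hI, hle⟩ := integral_growth_le hη hγ hanti hm hind hξ hmean hσ t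
    have h1 : ∫⁻ ω, ENNReal.ofReal (G t ω) ∂P ≤ ∫⁻ ω, ENNReal.ofReal (G t ω *
        (1 + (‖ema η (fun s => ξ s ω) t‖ / γ t) ^ 2)) ∂P := by
      refine lintegral_mono fun ω => ENNReal.ofReal_le_ofReal ?_
      have := hG1 t ω
      nlinarith [sq_nonneg (‖ema η (fun s => ξ s ω) t‖ / γ t)]
    refine h1.trans ?_
    rw [← ofReal_integral_eq_lintegral_ofReal hI
      (.of_forall fun ω => mul_nonneg (zero_le_one.trans (hG1 t ω)) (by positivity))]
    refine ENNReal.ofReal_le_ofReal (hle.trans ?_)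
    have h3 : ∀ s ∈ Finset.range (t + 1), 1 + σ ^ 2 / (γ s) ^ 2 ≤
        (1 + σ ^ 2 * C) * ((t : ℝ) + 1) := by
      intro s hs
      have hst : (s : ℝ) ≤ t := by exact_mod_cast Nat.lt_succ_iff.1 (Finset.mem_range.1 hs)
      have h4 : 1 / (γ s) ^ 2 ≤ C * ((t : ℝ) + 1) := (hC s).trans (by gcongr)
      have h5 := mul_le_mul_of_nonneg_left h4 (sq_nonneg σ)
      rw [mul_one_div] at h5
      have ht : (0 : ℝ) ≤ t := Nat.cast_nonneg t
      nlinarith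
    refine (Finset.sum_le_card_nsmul _ _ _ h3).trans (le_of_eq ?_)
    simp only [Finset.card_range, nsmul_eq_mul]
    push_cast
    ring
  -- Means of order `t ^ 2` against weights `(t + 1) ^ (-4)` are summable, so almost surely the
  -- weighted terms tend to 0. The exponent 4 becomes the factor of the logarithm.
  have hsum : ∫⁻ ω, ∑' t : ℕ, ENNReal.ofReal (G t ω) * ENNReal.ofReal (1 / ((t : ℝ) + 1) ^ 4) ∂P
      ≠ ⊤ := by
    rw [lintegral_tsum fun t => ((hGm t).ennreal_ofReal.mul_const _).aemeasurable]
    have hs : Summable fun t : ℕ => (1 + σ ^ 2 * C) * (1 / ((t : ℝ) + 1) ^ 2) := by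
      refine Summable.mul_left _ ?_
      have := (summable_nat_add_iff 1).2 (Real.summable_one_div_nat_pow.2 one_lt_two)
      simpa using this
    refine ne_top_of_le_ne_top (hs.tsum_ofReal_ne_top) (ENNReal.tsum_le_tsum fun t => ?_)
    rw [lintegral_mul_const _ (hGm t).ennreal_ofReal]
    refine (mul_le_mul_left (hGint t) _).trans ?_
    rw [← ENNReal.ofReal_mul (by positivity)]
    refine ENNReal.ofReal_le_ofReal (le_of_eq ?_)
    field_simp
  have hae := ae_lt_top' (AEMeasurable.tsum fun t =>
    ((hGm t).ennreal_ofReal.mul_const _).aemeasurable) hsum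
  filter_upwards [hae] with ω hω
  refine ⟨fun t => Real.log (G t ω), fun t => Real.log_nonneg (hG1 t ω),
    fun t => log_growth_succ _ t, ?_⟩
  have htend := ENNReal.tendsto_atTop_zero_of_tsum_ne_top hω.ne
  filter_upwards [htend.eventually (gt_mem_nhds one_pos)] with t ht
  rw [← ENNReal.ofReal_mul (zero_le_one.trans (hG1 t ω)), ENNReal.ofReal_lt_one] at ht
  have hpos : (0 : ℝ) < ((t : ℝ) + 1) ^ 4 := by positivity
  have hle : G t ω ≤ ((t : ℝ) + 1) ^ 4 := by
    rw [mul_one_div, div_lt_one hpos] at ht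
    exact ht.le
  calc Real.log (G t ω) ≤ Real.log (((t : ℝ) + 1) ^ 4) :=
        Real.log_le_log (zero_lt_one.trans_le (hG1 t ω)) hle
    _ = _ := by rw [Real.log_pow]; norm_num

end Noise

/-! ### Consensus: contraction of the disagreement -/

section Consensus

variable {n d : ℕ} {G : SimpleGraph (Fin n)} {W : Matrix (Fin n) (Fin n) ℝ}

lemma dotProduct_mulVec_comm (hW : W.IsHermitian) (u y : Fin n → ℝ) :
    u ⬝ᵥ W.mulVec y = W.mulVec u ⬝ᵥ y := by
  have ht : W.transpose = W := by
    rw [← Matrix.conjTranspose_eq_transpose_of_trivial]; exact hW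
  rw [Matrix.dotProduct_mulVec, ← Matrix.mulVec_transpose, ht]

/-- The spectral gap makes `W` a contraction on the vectors with mean zero. -/
lemma IsMixingMatrix.exists_contraction (hW : IsMixingMatrix G W) :
    ∃ l : ℝ, 0 ≤ l ∧ l < 1 ∧ ∀ y : Fin n → ℝ, ∑ i, y i = 0 →
      ∑ i, (W.mulVec y i) ^ 2 ≤ l ^ 2 * ∑ i, (y i) ^ 2 := by
  obtain ⟨i₀, hi₀, hlt⟩ := hW.spectral_gap
  set ev := hW.symmetric.eigenvalues
  set b := hW.symmetric.eigenvectorBasis with hb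
  -- Taking the supremum in the nonnegative reals gives the value 0 when there is a single agent.
  have hl : (Finset.univ.erase i₀).sup (fun i => ‖ev i‖₊) < 1 := by
    rw [Finset.sup_lt_iff (by simp)]
    intro i hi
    have h := hlt i (Finset.ne_of_mem_erase hi)
    rw [← NNReal.coe_lt_coe, coe_nnnorm, Real.norm_eq_abs]
    exact h
  set l := (Finset.univ.erase i₀).sup (fun i => ‖ev i‖₊) with hldef
  have hevl : ∀ i, i ≠ i₀ → |ev i| ≤ (l : ℝ) := fun i hi => by
    have h : ‖ev i‖₊ ≤ l := Finset.le_sup (f := fun i => ‖ev i‖₊)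
      (Finset.mem_erase.2 ⟨hi, Finset.mem_univ i⟩)
    exact_mod_cast h
  have heig : ∀ i (y : Fin n → ℝ), (b i).ofLp ⬝ᵥ W.mulVec y = ev i * ((b i).ofLp ⬝ᵥ y) := by
    intro i y
    rw [dotProduct_mulVec_comm hW.symmetric, hW.symmetric.mulVec_eigenvectorBasis i,
      smul_dotProduct, smul_eq_mul]
  have hinner : ∀ i (y : Fin n → ℝ), inner ℝ (b i) (WithLp.toLp 2 y) = (b i).ofLp ⬝ᵥ y := by
    intro i y
    simp [PiLp.inner_apply, dotProduct, mul_comm]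
  have hone : W.mulVec (fun _ => 1) = fun _ => 1 := by
    ext i
    simpa [Matrix.mulVec, dotProduct] using sum_row_of_mem_doublyStochastic hW.stochastic i
  -- The constant vector is fixed by `W`, so it is orthogonal to eigenvectors of eigenvalue other
  -- than 1. It is thus a nonzero multiple of `b i₀`, and mean-zero vectors have no `b i₀`
  -- component.
  have horth : ∀ i, i ≠ i₀ → (b i).ofLp ⬝ᵥ (fun _ => (1 : ℝ)) = 0 := by
    intro i hi
    have h := heig i (fun _ => 1)
    rw [hone] at h
    have h1 : ev i < 1 := (abs_lt.1 (hlt i hi)).2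
    have h2 : (1 - ev i) * ((b i).ofLp ⬝ᵥ fun _ => (1 : ℝ)) = 0 := by linarith
    rcases mul_eq_zero.1 h2 with h3 | h3
    · linarith
    · exact h3
  refine ⟨l, l.2, by exact_mod_cast hl, fun y hy => ?_⟩
  have hy0 : (b i₀).ofLp ⬝ᵥ y = 0 := by
    have h1 := b.sum_inner_mul_inner (WithLp.toLp 2 fun _ => (1 : ℝ)) (WithLp.toLp 2 y)
    rw [Finset.sum_eq_single i₀ (fun i _ hi => by
      rw [real_inner_comm, hinner, horth i hi, zero_mul]) (by simp), hinner, real_inner_comm,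
      hinner] at h1
    have h2 : inner ℝ (WithLp.toLp 2 fun _ => (1 : ℝ)) (WithLp.toLp 2 y) = 0 := by
      rw [← hy]; simp [PiLp.inner_apply]
    rw [h2] at h1
    rcases mul_eq_zero.1 h1 with h3 | h3
    · exfalso
      have h4 := b.sum_sq_inner_right (WithLp.toLp 2 fun _ => (1 : ℝ))
      rw [Finset.sum_eq_single i₀ (fun i _ hi => by rw [hinner, horth i hi]; simp) (by simp),
        hinner, h3, EuclideanSpace.norm_sq_eq] at h4
      have h5 : (n : ℝ) = 0 := by simpa using h4.symm
      exact i₀.pos.ne' (by exact_mod_cast h5)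
    · exact h3
  have hsq : ∀ w : Fin n → ℝ, ∑ i, (w i) ^ 2 = ∑ i, ((b i).ofLp ⬝ᵥ w) ^ 2 := by
    intro w
    have h4 := b.sum_sq_inner_right (WithLp.toLp 2 w)
    rw [EuclideanSpace.norm_sq_eq] at h4
    simp_rw [hinner] at h4
    simpa using h4.symm
  rw [hsq (W.mulVec y), hsq y, Finset.mul_sum]
  refine Finset.sum_le_sum fun i _ => ?_
  rw [heig, mul_pow]
  by_cases hi : i = i₀
  · rw [hi, hy0]; simp
  · have h5 := pow_le_pow_left₀ (abs_nonneg _) (hevl i hi) 2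
    rw [sq_abs] at h5
    gcongr

/-- The mixing acts on each coordinate of `ℝ^d` separately, so the scalar contraction is summed over
coordinates. -/
lemma sum_norm_sq_mix_le {l : ℝ} (hl : ∀ y : Fin n → ℝ, ∑ i, y i = 0 →
      ∑ i, (W.mulVec y i) ^ 2 ≤ l ^ 2 * ∑ i, (y i) ^ 2) (y : Fin n → Vec d) (hy : ∑ i, y i = 0) :
    ∑ i, ‖∑ j, W i j • y j‖ ^ 2 ≤ l ^ 2 * ∑ i, ‖y i‖ ^ 2 := by
  simp_rw [EuclideanSpace.norm_sq_eq, Real.norm_eq_abs, sq_abs]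
  rw [Finset.sum_comm, Finset.sum_comm (f := fun i k => (y i k) ^ 2), Finset.mul_sum]
  refine Finset.sum_le_sum fun k _ => ?_
  have hk : ∑ i, y i k = 0 := by
    have := congrArg (fun v : Vec d => v k) hy
    simpa using this
  refine le_trans (le_of_eq ?_) (hl (fun i => y i k) hk)
  refine Finset.sum_congr rfl fun i _ => ?_
  simp [Matrix.mulVec, dotProduct]

/-- The average of the vectors `x i`. -/
def average (x : Fin n → Vec d) : Vec d := (n : ℝ)⁻¹ • ∑ i, x i

/-- The Euclidean distance of the family `x` from consensus. -/
def disagreement (x : Fin n → Vec d) : ℝ := √(∑ i, ‖x i - average x‖ ^ 2)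

lemma norm_sub_average_le (x : Fin n → Vec d) (i : Fin n) :
    ‖x i - average x‖ ≤ disagreement x := by
  refine Real.le_sqrt_of_sq_le ?_
  exact Finset.single_le_sum (f := fun i => ‖x i - average x‖ ^ 2) (fun _ _ => by positivity)
    (Finset.mem_univ i)

lemma sum_sub_average (hn : 0 < n) (x : Fin n → Vec d) : ∑ i, (x i - average x) = 0 := by
  have : (n : ℝ) ≠ 0 := by exact_mod_cast hn.ne'
  rw [Finset.sum_sub_distrib, Finset.sum_const, Finset.card_univ, Fintype.card_fin, average,
    ← Nat.cast_smul_eq_nsmul ℝ, smul_smul, mul_inv_cancel₀ this, one_smul, sub_self]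

lemma norm_average_le (hn : 0 < n) {x : Fin n → Vec d} {B : ℝ} (hx : ∀ i, ‖x i‖ ≤ B) :
    ‖average x‖ ≤ B := by
  have hn' : (0 : ℝ) < n := by exact_mod_cast hn
  rw [average, norm_smul, norm_inv, Real.norm_natCast, inv_mul_le_iff₀ hn']
  refine (norm_sum_le _ _).trans ?_
  refine (Finset.sum_le_card_nsmul _ _ B fun i _ => hx i).trans (le_of_eq ?_)
  simp

lemma average_mix (hW : W ∈ doublyStochastic ℝ (Fin n)) (y : Fin n → Vec d) :
    average (fun i => ∑ j, W i j • y j) = average y := by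
  unfold average
  rw [Finset.sum_comm]
  simp_rw [← Finset.sum_smul, sum_col_of_mem_doublyStochastic hW, one_smul]

lemma average_sub_smul (x c : Fin n → Vec d) (a : ℝ) :
    average (fun i => x i - a • c i) = average x - a • average c := by
  unfold average
  rw [Finset.sum_sub_distrib, smul_sub, ← Finset.smul_sum, smul_comm]

lemma disagreement_eq_norm (x : Fin n → Vec d) :
    disagreement x = ‖(WithLp.toLp 2 fun i => x i - average x : PiLp 2 fun _ : Fin n => Vec d)‖ := by
  rw [PiLp.norm_eq_of_L2, disagreement]

/-- One mixing step contracts the disagreement, up to the size of the perturbation. -/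
lemma disagreement_step (hn : 0 < n) (hW : W ∈ doublyStochastic ℝ (Fin n)) {l : ℝ} (hl0 : 0 ≤ l)
    (hl : ∀ y : Fin n → ℝ, ∑ i, y i = 0 → ∑ i, (W.mulVec y i) ^ 2 ≤ l ^ 2 * ∑ i, (y i) ^ 2)
    (x c : Fin n → Vec d) {a B : ℝ} (ha : 0 ≤ a) (hc : ∀ i, ‖c i‖ ≤ B) :
    disagreement (fun i => ∑ j, W i j • (x j - a • c j)) ≤
      l * (disagreement x + a * (√n * (2 * B))) := by
  have hB : 0 ≤ B := (norm_nonneg _).trans (hc ⟨0, hn⟩)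
  set y : Fin n → Vec d := fun i => x i - a • c i with hy
  have h1 : disagreement (fun i => ∑ j, W i j • y j) ≤ l * disagreement y := by
    unfold disagreement
    rw [average_mix hW]
    have h2 := sum_norm_sq_mix_le hl (fun i => y i - average y) (sum_sub_average hn y)
    have h3 : ∀ i, ∑ j, W i j • (y j - average y) = (∑ j, W i j • y j) - average y := by
      intro i
      simp_rw [smul_sub]
      rw [Finset.sum_sub_distrib, ← Finset.sum_smul, sum_row_of_mem_doublyStochastic hW, one_smul]
    simp_rw [h3] at h2
    calc _ ≤ √(l ^ 2 * ∑ i, ‖y i - average y‖ ^ 2) := Real.sqrt_le_sqrt h2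
      _ = _ := by rw [Real.sqrt_mul (sq_nonneg l), Real.sqrt_sq hl0]
  refine h1.trans (mul_le_mul_of_nonneg_left ?_ hl0)
  have h4 : disagreement y ≤ disagreement x + a * disagreement c := by
    rw [disagreement_eq_norm, disagreement_eq_norm, disagreement_eq_norm]
    have h5 : (WithLp.toLp 2 fun i => y i - average y : PiLp 2 fun _ : Fin n => Vec d) =
        (WithLp.toLp 2 fun i => x i - average x) - a • (WithLp.toLp 2 fun i => c i - average c) := by
      ext1 i
      simp only [hy, average_sub_smul, WithLp.ofLp_sub, WithLp.ofLp_smul, Pi.sub_apply,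
        Pi.smul_apply, smul_sub]
      abel
    rw [h5]
    refine (norm_sub_le _ _).trans ?_
    rw [norm_smul, Real.norm_eq_abs, abs_of_nonneg ha]
  refine h4.trans ?_
  gcongr
  unfold disagreement
  have h6 : ∑ i, ‖c i - average c‖ ^ 2 ≤ n * (2 * B) ^ 2 := by
    refine (Finset.sum_le_card_nsmul _ _ ((2 * B) ^ 2) fun i _ => ?_).trans (le_of_eq (by simp))
    have := (norm_sub_le (c i) (average c)).trans (add_le_add (hc i) (norm_average_le hn hc))
    gcongr
    linarith
  calc _ ≤ √(n * (2 * B) ^ 2) := Real.sqrt_le_sqrt h6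
    _ = _ := by rw [Real.sqrt_mul (Nat.cast_nonneg n), Real.sqrt_sq (by positivity)]

end Consensus

/-! ### Polynomial schedules and recursive inequalities -/

section Schedule

variable {c a : ℝ} {φ : ℕ}

lemma one_le_shift (hφ : 0 < φ) (t : ℕ) : (1 : ℝ) ≤ (t : ℝ) + φ := by
  have : (1 : ℝ) ≤ φ := by exact_mod_cast hφ
  have : (0 : ℝ) ≤ t := Nat.cast_nonneg t
  linarith

lemma tendsto_shift (φ : ℕ) : Tendsto (fun t : ℕ => (t : ℝ) + φ) atTop atTop :=
  tendsto_atTop_add_const_right _ _ tendsto_natCast_atTop_atTop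

lemma schedule_pos (hc : 0 < c) (hφ : 0 < φ) (t : ℕ) : 0 < schedule c φ a t :=
  mul_pos hc (Real.rpow_pos_of_pos (zero_lt_one.trans_le (one_le_shift hφ t)) _)

lemma schedule_mul (hφ : 0 < φ) (c c' a a' : ℝ) (t : ℕ) :
    schedule c φ a t * schedule c' φ a' t = schedule (c * c') φ (a + a') t := by
  have := zero_lt_one.trans_le (one_le_shift hφ t)
  unfold schedule
  rw [neg_add, Real.rpow_add this]
  ring

lemma schedule_div (hφ : 0 < φ) (c c' a a' : ℝ) (t : ℕ) :
    schedule c φ a t / schedule c' φ a' t = schedule (c / c') φ (a - a') t := by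
  have := zero_lt_one.trans_le (one_le_shift hφ t)
  unfold schedule
  rw [neg_sub, Real.rpow_sub this, Real.rpow_neg this.le, Real.rpow_neg this.le]
  field_simp

lemma tendsto_schedule (c : ℝ) (φ : ℕ) (ha : 0 < a) :
    Tendsto (schedule c φ a) atTop (𝓝 0) := by
  have := ((tendsto_rpow_neg_atTop ha).comp (tendsto_shift φ)).const_mul c
  rw [mul_zero] at this
  exact this

/-- With `s = t + φ`, it follows from `(1 + 1 / s) ^ a ≤ exp (a / s)` and `1 - a / s ≤ exp (-(a /
s))`. The relative decrement is thus `O(1 / t)`, the sense in which schedules vary slowly. -/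
lemma schedule_one_sub_le (hc : 0 ≤ c) (ha : 0 ≤ a) (hφ : 0 < φ) (t : ℕ) :
    schedule c φ a t * (1 - a / ((t : ℝ) + φ)) ≤ schedule c φ a (t + 1) := by
  have hs := zero_lt_one.trans_le (one_le_shift hφ t)
  unfold schedule
  rw [mul_assoc]
  refine mul_le_mul_of_nonneg_left ?_ hc
  set s : ℝ := (t : ℝ) + φ
  have h1 : ((t + 1 : ℕ) : ℝ) + φ = s * (1 + 1 / s) := by
    push_cast; field_simp; simp only [s]; ring
  rw [h1, Real.mul_rpow hs.le (by positivity)]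
  refine mul_le_mul_of_nonneg_left ?_ (by positivity)
  have h2 : (1 + 1 / s) ^ a ≤ Real.exp (a / s) := by
    have : 1 + 1 / s ≤ Real.exp (1 / s) := by
      rw [add_comm]; exact Real.add_one_le_exp _
    calc _ ≤ (Real.exp (1 / s)) ^ a := Real.rpow_le_rpow (by positivity) this ha
      _ = _ := by rw [← Real.exp_mul]; congr 1; ring
  rw [Real.rpow_neg (by positivity)]
  calc 1 - a / s ≤ Real.exp (-(a / s)) := by
        have := Real.add_one_le_exp (-(a / s)); linarith
    _ = (Real.exp (a / s))⁻¹ := Real.exp_neg _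
    _ ≤ _ := inv_anti₀ (by positivity) h2

lemma schedule_succ_le (hc : 0 ≤ c) (ha : 0 ≤ a) (hφ : 0 < φ) (t : ℕ) :
    schedule c φ a (t + 1) ≤ schedule c φ a t := by
  have hs := zero_lt_one.trans_le (one_le_shift hφ t)
  unfold schedule
  refine mul_le_mul_of_nonneg_left ?_ hc
  refine Real.rpow_le_rpow_of_nonpos hs ?_ (by linarith)
  push_cast; linarith

lemma tendsto_const_div_shift (K : ℝ) (φ : ℕ) :
    Tendsto (fun t : ℕ => K / ((t : ℝ) + φ)) atTop (𝓝 0) :=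
  (tendsto_shift φ).const_div_atTop K

lemma eventually_half_le_schedule_succ (hc : 0 ≤ c) (ha : 0 ≤ a) (hφ : 0 < φ) :
    ∀ᶠ t in atTop, schedule c φ a t / 2 ≤ schedule c φ a (t + 1) := by
  filter_upwards [(tendsto_const_div_shift a φ).eventually (ge_mem_nhds one_half_pos)] with t ht
  refine le_trans ?_ (schedule_one_sub_le hc ha hφ t)
  have hs := zero_lt_one.trans_le (one_le_shift hφ t)
  have : 0 ≤ schedule c φ a t := mul_nonneg hc (Real.rpow_nonneg hs.le _)
  nlinarith

lemma eventually_div_shift_le_schedule (K : ℝ) (hc : 0 < c) (ha : a < 1) (hφ : 0 < φ) {δ : ℝ}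
    (hδ : 0 < δ) : ∀ᶠ t : ℕ in atTop, K / ((t : ℝ) + φ) ≤ δ * schedule c φ a t := by
  have h := tendsto_schedule (K / c) φ (a := 1 - a) (by linarith)
  filter_upwards [h.eventually (ge_mem_nhds hδ)] with t ht
  have hp := schedule_pos (a := a) hc hφ t
  rw [← schedule_div hφ, div_le_iff₀ hp] at ht
  refine le_trans (le_of_eq ?_) ht
  rw [schedule, Real.rpow_neg_one, div_eq_mul_inv]

lemma tendsto_log_mul_schedule (c : ℝ) (hφ : 0 < φ) (ha : 0 < a) :
    Tendsto (fun t : ℕ => Real.log ((t : ℝ) + 2) * schedule c φ a t) atTop (𝓝 0) := by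
  have h1 : Tendsto (fun s : ℝ => (Real.log 2 + Real.log s) * (c * s ^ (-a))) atTop (𝓝 0) := by
    have h2 : Tendsto (fun s : ℝ => Real.log s * s ^ (-a)) atTop (𝓝 0) := by
      have := (isLittleO_log_rpow_atTop ha).tendsto_div_nhds_zero
      refine this.congr' ?_
      filter_upwards [eventually_gt_atTop 0] with s hs
      rw [Real.rpow_neg hs.le, div_eq_mul_inv]
    have h3 := ((tendsto_rpow_neg_atTop ha).const_mul (c * Real.log 2)).add (h2.const_mul c)
    simp only [mul_zero, add_zero] at h3
    refine h3.congr fun s => by ring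
  have h4 := (h1.comp (tendsto_shift φ)).abs
  rw [abs_zero] at h4
  refine squeeze_zero_norm (fun t => ?_) h4
  have hs := one_le_shift hφ t
  have ht : (0 : ℝ) ≤ t := Nat.cast_nonneg t
  have hφ1 : (1 : ℝ) ≤ φ := by exact_mod_cast hφ
  have h5 : Real.log ((t : ℝ) + 2) ≤ Real.log 2 + Real.log ((t : ℝ) + φ) := by
    rw [← Real.log_mul (by norm_num) (by positivity)]
    exact Real.log_le_log (by positivity) (by linarith)
  have h6 : 0 ≤ Real.log ((t : ℝ) + 2) := Real.log_nonneg (by linarith)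
  rw [Real.norm_eq_abs, Function.comp_apply, abs_mul, abs_mul, abs_of_nonneg h6,
    abs_of_nonneg (h6.trans h5)]
  exact mul_le_mul_of_nonneg_right h5 (abs_nonneg _)

lemma not_summable_schedule (hc : 0 < c) (ha : a ≤ 1) : ¬ Summable (schedule c φ a) := by
  intro h
  have h1 : Summable fun t : ℕ => ((t + φ : ℕ) : ℝ) ^ (-a) := by
    have := h.mul_left c⁻¹
    refine this.congr fun t => ?_
    unfold schedule
    push_cast
    field_simp
  rw [summable_nat_add_iff (f := fun t : ℕ => (t : ℝ) ^ (-a)), Real.summable_nat_rpow] at h1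
  linarith

lemma schedule_sq_ratio_le (hc : 0 < c) (ha : 0 ≤ a) (hφ : 0 < φ) :
    ∃ K : ℝ, ∀ᶠ t : ℕ in atTop,
      (schedule c φ a t) ^ 2 / (schedule c φ a (t + 1)) ^ 2 - 1 ≤ K / ((t : ℝ) + φ) := by
  refine ⟨6 * a, ?_⟩
  filter_upwards [(tendsto_const_div_shift a φ).eventually (ge_mem_nhds one_half_pos),
    (tendsto_const_div_shift a φ).eventually (ge_mem_nhds (show (0 : ℝ) < 1 / 6 by norm_num))]
    with t ht ht2
  have hs := zero_lt_one.trans_le (one_le_shift hφ t)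
  have h1 := schedule_one_sub_le hc.le ha hφ t
  have hp := schedule_pos (a := a) hc hφ t
  have hp1 := schedule_pos (a := a) hc hφ (t + 1)
  have hu : 0 ≤ a / ((t : ℝ) + φ) := by positivity
  rw [mul_div_assoc]
  set u := a / ((t : ℝ) + φ)
  rw [sub_le_iff_le_add, div_le_iff₀ (by positivity)]
  have h2 : (schedule c φ a t * (1 - u)) ^ 2 ≤ (schedule c φ a (t + 1)) ^ 2 :=
    pow_le_pow_left₀ (mul_nonneg hp.le (by linarith)) h1 2
  have h3 : 1 ≤ (6 * u + 1) * (1 - u) ^ 2 := by nlinarith [mul_nonneg hu hu]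
  calc (schedule c φ a t) ^ 2 = 1 * (schedule c φ a t) ^ 2 := (one_mul _).symm
    _ ≤ ((6 * u + 1) * (1 - u) ^ 2) * (schedule c φ a t) ^ 2 := by gcongr
    _ = (6 * u + 1) * (schedule c φ a t * (1 - u)) ^ 2 := by ring
    _ ≤ _ := by gcongr

/-- A perturbed contraction towards a slowly varying sequence stays comparable to it. -/
lemma exists_le_mul_schedule (hc : 0 < c) (ha : 0 ≤ a) (hφ : 0 < φ) {l y : ℕ → ℝ}
    (hl : ∀ t, 0 ≤ l t ∧ l t ≤ 1) (hslow : ∀ᶠ t : ℕ in atTop, a / ((t : ℝ) + φ) ≤ l t / 2)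
    (hy : ∀ t, y (t + 1) ≤ (1 - l t) * y t + l t * schedule c φ a t) :
    ∃ C : ℝ, 0 ≤ C ∧ ∀ t, y t ≤ C * schedule c φ a t := by
  obtain ⟨T, hT⟩ := eventually_atTop.1 hslow
  -- The sum covers the times up to `T`. Afterwards, `C ≥ 2` lets half of the contraction absorb the
  -- forcing term while the other half pays for the decay of the schedule.
  set C := 2 + ∑ t ∈ Finset.range (T + 1), |y t| / schedule c φ a t
  have hpos := schedule_pos (a := a) hc hφ
  have hsum : 0 ≤ ∑ t ∈ Finset.range (T + 1), |y t| / schedule c φ a t :=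
    Finset.sum_nonneg fun t _ => div_nonneg (abs_nonneg _) (hpos t).le
  have hsmall : ∀ t ≤ T, y t ≤ C * schedule c φ a t := by
    intro t ht
    have h1 : |y t| / schedule c φ a t ≤ C := by
      refine le_trans (Finset.single_le_sum (f := fun t => |y t| / schedule c φ a t)
        (fun t _ => div_nonneg (abs_nonneg _) (hpos t).le)
        (Finset.mem_range.2 (Nat.lt_succ_of_le ht))) ?_
      simp only [C]; linarith
    rw [div_le_iff₀ (hpos t)] at h1
    exact (le_abs_self _).trans h1
  have hC : 2 ≤ C := by simp only [C]; linarith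
  refine ⟨C, by linarith, fun t => ?_⟩
  rcases le_total t T with h | h
  · exact hsmall t h
  · induction t, h using Nat.le_induction with
    | base => exact hsmall T le_rfl
    | succ t ht ih =>
      have h1 := hT t ht
      have h2 := schedule_one_sub_le hc.le ha hφ t
      have h3 := mul_le_mul_of_nonneg_left ih (sub_nonneg.2 (hl t).2)
      have hp := hpos t
      have h4 : schedule c φ a t * (1 - l t / 2) ≤ schedule c φ a (t + 1) :=
        le_trans (mul_le_mul_of_nonneg_left (by linarith) hp.le) h2
      have h5 := mul_le_mul_of_nonneg_left h4 (by linarith : 0 ≤ C)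
      have h6 : 0 ≤ (C - 2) * (l t * schedule c φ a t) :=
        mul_nonneg (by linarith) (mul_nonneg (hl t).1 hp.le)
      have := hy t
      nlinarith

/-- A nonnegative sequence which decreases by `c α γ` above the level `γ / L`, up to the increments
of a potential `H` of logarithmic growth, is of the order of `γ`, up to the potential. -/
lemma eventually_le_of_descent {cα cγ cη τα τγ τη c K L A : ℝ} (hφ : 0 < φ)
    (hcα : 0 < cα) (hcγ : 0 < cγ) (hcη : 0 < cη) (hτα : 0 < τα) (hτγ : 0 < τγ)
    (hη1 : τη < 1) (hsum : τα + τγ < 1) (hητ : τη < τα + τγ) (hc : 0 < c) (hK : 0 ≤ K) (hL : 0 < L)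
    (hα1 : ∀ t, schedule cα φ τα t < 1)
    {r H : ℕ → ℝ} (hH : ∀ t, 0 ≤ H t)
    (hHlog : ∀ᶠ t : ℕ in atTop, H t ≤ A * Real.log ((t : ℝ) + 1))
    (hdesc : ∀ᶠ t in atTop, schedule cγ φ τγ t / L ≤ r t →
      r (t + 1) ≤ r t - c * (schedule cα φ τα t * schedule cγ φ τγ t) +
        K * (schedule cα φ τα t * schedule cγ φ τγ t / schedule cη φ τη t) * (H (t + 1) - H t))
    (hnear : ∀ᶠ t in atTop, r t < schedule cγ φ τγ t / L →
      r (t + 1) ≤ r t + schedule cα φ τα t * schedule cγ φ τγ t) :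
    ∃ M : ℝ, ∀ᶠ t : ℕ in atTop, r t ≤ M * schedule cγ φ τγ t +
      K * (schedule cα φ τα t * schedule cγ φ τγ t / schedule cη φ τη t) *
        (A * Real.log ((t : ℝ) + 1)) := by
  set α := schedule cα φ τα with hαdef
  set γ := schedule cγ φ τγ with hγdef
  set η := schedule cη φ τη with hηdef
  set b : ℕ → ℝ := fun t => α t * γ t / η t with hb
  have hbs : ∀ t, b t = schedule (cα * cγ / cη) φ (τα + τγ - τη) t := fun t => by
    simp only [hb, hαdef, hγdef, hηdef]; rw [schedule_mul hφ, schedule_div hφ]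
  have hαp : ∀ t, 0 < α t := schedule_pos hcα hφ
  have hγp : ∀ t, 0 < γ t := schedule_pos hcγ hφ
  have hηp : ∀ t, 0 < η t := schedule_pos hcη hφ
  have hbp : ∀ t, 0 < b t := fun t => div_pos (mul_pos (hαp t) (hγp t)) (hηp t)
  have hbslow : ∀ t : ℕ, b t - b (t + 1) ≤ b t * ((τα + τγ - τη) / ((t : ℝ) + φ)) := fun t => by
    have := schedule_one_sub_le (c := cα * cγ / cη) (a := τα + τγ - τη) (by positivity)
      (by linarith) hφ t
    rw [← hbs, ← hbs] at this
    linarith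
  -- Starting below `γ / L`, one step reaches at most `(1 / L + 1) γ t`; the factor 2 converts `γ t`
  -- into `γ (t + 1)`.
  set M := 2 * (1 / L + 1) with hM
  have hMp : 0 < M := by positivity
  -- Cost of the changing weight `b` in summation by parts: `b log t / t` equals `α γ` times `log t
  -- / (t η)` up to constants, hence is `o(α γ)` because `τη < 1`.
  have hE1 : ∀ᶠ t : ℕ in atTop, K * (b t - b (t + 1)) * H (t + 1) ≤ c / 2 * (α t * γ t) := by
    have hlim := tendsto_log_mul_schedule (K * |A| * (τα + τγ - τη) / cη) hφ (a := 1 - τη)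
      (sub_pos.2 hη1)
    filter_upwards [(tendsto_add_atTop_nat 1).eventually hHlog,
      hlim.eventually (ge_mem_nhds (half_pos hc))] with t h1 h2
    have hs := zero_lt_one.trans_le (one_le_shift hφ t)
    push_cast at h1
    rw [add_assoc, one_add_one_eq_two] at h1
    have hlog : 0 ≤ Real.log ((t : ℝ) + 2) :=
      Real.log_nonneg (by have : (0 : ℝ) ≤ t := Nat.cast_nonneg t; linarith)
    have h3 : H (t + 1) ≤ |A| * Real.log ((t : ℝ) + 2) :=
      h1.trans (mul_le_mul_of_nonneg_right (le_abs_self A) hlog)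
    have hq : 0 ≤ (τα + τγ - τη) / ((t : ℝ) + φ) := div_nonneg (by linarith) hs.le
    calc K * (b t - b (t + 1)) * H (t + 1) ≤
          K * (b t * ((τα + τγ - τη) / ((t : ℝ) + φ))) * (|A| * Real.log ((t : ℝ) + 2)) := by
          have := hbslow t
          have h5 := hH (t + 1)
          have h6 := hbp t
          gcongr
      _ = (Real.log ((t : ℝ) + 2) * (schedule (K * |A| * (τα + τγ - τη)) φ 1 t / η t)) *
          (α t * γ t) := by
          simp only [hb, schedule, Real.rpow_neg_one]
          field_simp
      _ ≤ _ := by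
          rw [hηdef, schedule_div hφ]
          have := hαp t
          have := hγp t
          gcongr
  -- The barrier `M γ` sinks more slowly than the descent, since `1 / t = o(α)`; once below it, the
  -- Lyapunov function stays below.
  have hE2 : ∀ᶠ t : ℕ in atTop, M * (γ t - γ (t + 1)) ≤ c / 2 * (α t * γ t) := by
    filter_upwards [eventually_div_shift_le_schedule (M * τγ) hcα (a := τα) (by linarith) hφ
      (half_pos hc)] with t ht
    have h1 := schedule_one_sub_le hcγ.le hτγ.le hφ t
    have h2 := mul_le_mul_of_nonneg_right ht (hγp t).le
    have h3 := mul_le_mul_of_nonneg_left h1 hMp.le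
    rw [mul_div_assoc] at h2
    linarith
  obtain ⟨T, hT⟩ := eventually_atTop.1 (hdesc.and (hnear.and (hE1.and (hE2.and
    (eventually_half_le_schedule_succ hcγ.le hτγ.le hφ)))))
  set S : ℕ → ℝ := fun t => r t - K * b t * H t with hS
  have hstep : ∀ t, T ≤ t → S (t + 1) ≤ S t - c / 2 * (α t * γ t) ∨ S (t + 1) ≤ M * γ (t + 1) := by
    intro t ht
    obtain ⟨h1, h2, h3, -, h5⟩ := hT t ht
    rcases le_or_gt (γ t / L) (r t) with h | h
    · left
      have := h1 h
      simp only [hS]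
      nlinarith
    · right
      have h6 := h2 h
      have h7 : 0 ≤ K * b (t + 1) * H (t + 1) :=
        mul_nonneg (mul_nonneg hK (hbp _).le) (hH _)
      have h8 : α t * γ t ≤ γ t := by nlinarith [hα1 t, hγp t]
      have h9 : M * (γ t / 2) ≤ M * γ (t + 1) := mul_le_mul_of_nonneg_left h5 hMp.le
      have h10 : M * (γ t / 2) = γ t / L + γ t := by rw [hM]; ring
      simp only [hS]
      linarith
  -- Otherwise `S` would remain positive while losing a multiple of the divergent series `∑ α γ`.
  have hhit : ∃ t, T ≤ t ∧ S t ≤ M * γ t := by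
    by_contra! hno
    have hdec : ∀ k, S (T + k) ≤ S T - c / 2 * ∑ j ∈ Finset.range k, α (T + j) * γ (T + j) := by
      intro k
      induction k with
      | zero => simp
      | succ k ih =>
        rcases hstep (T + k) (Nat.le_add_right _ _) with h | h
        · rw [Finset.sum_range_succ, ← add_assoc]; linarith
        · exact absurd h (not_le.2 (hno (T + k + 1) (by omega)))
    have hns : ¬ Summable fun j => α (T + j) * γ (T + j) := by
      have h1 : (fun j => α (T + j) * γ (T + j)) =
          fun j => schedule (cα * cγ) φ (τα + τγ) (j + T) := by
        funext j
        rw [hαdef, hγdef, schedule_mul hφ, add_comm j T]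
      rw [h1, summable_nat_add_iff]
      exact not_summable_schedule (by positivity) hsum.le
    have hdiv := (not_summable_iff_tendsto_nat_atTop_of_nonneg
      (fun j => (mul_pos (hαp (T + j)) (hγp (T + j))).le)).1 hns
    obtain ⟨k, hk⟩ := (hdiv.eventually_gt_atTop (S T / (c / 2))).exists
    rw [div_lt_iff₀ (half_pos hc)] at hk
    have h1 := hdec k
    have h2 := hno (T + k) (Nat.le_add_right _ _)
    have h3 := mul_pos hMp (hγp (T + k))
    linarith
  obtain ⟨T', hTT', hT'⟩ := hhit
  have hall : ∀ t, T' ≤ t → S t ≤ M * γ t := by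
    intro t ht
    induction t, ht using Nat.le_induction with
    | base => exact hT'
    | succ t ht ih =>
      obtain ⟨-, -, -, h4, -⟩ := hT t (hTT'.trans ht)
      rcases hstep t (hTT'.trans ht) with h | h
      · linarith
      · exact h
  refine ⟨M, ?_⟩
  filter_upwards [hHlog, eventually_ge_atTop T'] with t h1 h2
  have h3 := hall t h2
  have h4 := mul_le_mul_of_nonneg_left h1 (mul_nonneg hK (hbp t).le)
  simp only [hS] at h3
  linarith

end Schedule

/-! ### Clipping and its sensitivity to noise -/

section Clip

variable {d : ℕ}

/-- The vector `v` clipped at the threshold `γ`. -/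
def clip (γ : ℝ) (v : Vec d) : Vec d := clipCoeff γ v • v

lemma clipCoeff_eq {γ : ℝ} (hγ : 0 < γ) (v : Vec d) : clipCoeff γ v = γ / max γ ‖v‖ := by
  unfold clipCoeff
  split_ifs with h
  · rw [max_eq_left h, div_self hγ.ne']
  · rw [max_eq_right (not_le.1 h).le, div_eq_mul_inv]

lemma norm_clip_le {γ : ℝ} (hγ : 0 < γ) (v : Vec d) : ‖clip γ v‖ ≤ γ := by
  have hm : 0 < max γ ‖v‖ := lt_max_of_lt_left hγ
  rw [clip, clipCoeff_eq hγ, norm_smul, Real.norm_eq_abs, abs_of_nonneg (by positivity),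
    div_mul_eq_mul_div, div_le_iff₀ hm]
  exact mul_le_mul_of_nonneg_left (le_max_right _ _) hγ.le

lemma norm_clip_sub_clip_le {γ : ℝ} (hγ : 0 < γ) (v w : Vec d) :
    ‖clip γ v - clip γ w‖ ≤ 2 * ‖v - w‖ := by
  rw [clip, clip, clipCoeff_eq hγ, clipCoeff_eq hγ]
  have ha : 0 < max γ ‖v‖ := lt_max_of_lt_left hγ
  have hb : 0 < max γ ‖w‖ := lt_max_of_lt_left hγ
  have hab : |max γ ‖w‖ - max γ ‖v‖| ≤ ‖v - w‖ := by
    rw [max_comm γ, max_comm γ, norm_sub_rev]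
    exact (abs_max_sub_max_le_abs _ _ _).trans (abs_norm_sub_norm_le w v)
  have hva : γ / max γ ‖v‖ ≤ 1 := (div_le_one ha).2 (le_max_left _ _)
  have hwb : ‖w‖ / max γ ‖w‖ ≤ 1 := (div_le_one hb).2 (le_max_right _ _)
  set a := max γ ‖v‖
  set b := max γ ‖w‖
  have heq : (γ / a) • v - (γ / b) • w = (γ / a) • (v - w) + ((γ / a) * ((b - a) / b)) • w := by
    have : γ / b = γ / a - (γ / a) * ((b - a) / b) := by field_simp; ring
    rw [this]; module
  rw [heq]
  refine (norm_add_le _ _).trans ?_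
  rw [norm_smul, norm_smul, Real.norm_eq_abs, Real.norm_eq_abs, abs_of_nonneg (by positivity),
    abs_mul, abs_of_nonneg (by positivity : 0 ≤ γ / a), abs_div, abs_of_pos hb]
  have h1 : γ / a * ‖v - w‖ ≤ 1 * ‖v - w‖ := by gcongr
  have h2 : γ / a * (|b - a| / b) * ‖w‖ ≤ 1 * ‖v - w‖ := by
    calc γ / a * (|b - a| / b) * ‖w‖ = γ / a * (‖w‖ / b) * |b - a| := by ring
      _ ≤ 1 * 1 * ‖v - w‖ := by gcongr
      _ = _ := by ring
  linarith

/-- Clipping rescales `g` by `γ / max γ ‖g‖`, which is at least `γ / B`. -/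
lemma div_mul_inner_le_inner_clip {γ B : ℝ} (hγ : 0 < γ) (hB : γ ≤ B) {g u : Vec d}
    (hg : ‖g‖ ≤ B) (h0 : 0 ≤ inner ℝ g u) : γ / B * inner ℝ g u ≤ inner ℝ (clip γ g) u := by
  rw [clip, inner_smul_left, clipCoeff_eq hγ, conj_trivial]
  have hm : 0 < max γ ‖g‖ := lt_max_of_lt_left hγ
  have := max_le hB hg
  gcongr

/-- Below `ε` the first term suffices; above it, monotonicity of `x ^ 2 / (1 + x ^ 2)` makes the
second at least 1. This trades a small constant clipping error for saturated energy. -/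
lemma min_ratio_le {ε x : ℝ} (hε : 0 < ε) :
    min x 1 ≤ ε + (1 + ε ^ 2) / ε ^ 2 * (x ^ 2 / (1 + x ^ 2)) := by
  rcases le_total x ε with h | h
  · refine (min_le_left _ _).trans (h.trans ?_)
    have : 0 ≤ (1 + ε ^ 2) / ε ^ 2 * (x ^ 2 / (1 + x ^ 2)) := by positivity
    linarith
  · refine (min_le_right _ _).trans ?_
    have : 1 ≤ (1 + ε ^ 2) / ε ^ 2 * (x ^ 2 / (1 + x ^ 2)) := by
      rw [div_mul_div_comm, one_le_div (by positivity)]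
      have := pow_le_pow_left₀ hε.le h 2
      nlinarith
    linarith

/-- Clipping error in terms of the saturated energy of the noise component `z` of `v`. -/
lemma norm_clip_sub_clip_le_noise {γ ε : ℝ} (hγ : 0 < γ) (hε : 0 < ε) (v z g : Vec d) :
    ‖clip γ v - clip γ g‖ ≤
      2 * γ * (ε + (1 + ε ^ 2) / ε ^ 2 * ((‖z‖ / γ) ^ 2 / (1 + (‖z‖ / γ) ^ 2))) +
        2 * ‖v - z - g‖ := by
  have h1 : ‖clip γ v - clip γ g‖ ≤ ‖clip γ v - clip γ (v - z)‖ + ‖clip γ (v - z) - clip γ g‖ :=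
    norm_sub_le_norm_sub_add_norm_sub _ _ _
  have h2 := norm_clip_sub_clip_le hγ (v - z) g
  have h3 : ‖clip γ v - clip γ (v - z)‖ ≤ 2 * γ * min (‖z‖ / γ) 1 := by
    rw [mul_min_of_nonneg _ _ (by positivity)]
    refine le_min ?_ ?_
    · have := norm_clip_sub_clip_le hγ v (v - z)
      rw [sub_sub_cancel] at this
      refine this.trans (le_of_eq ?_)
      field_simp
    · have := (norm_sub_le (clip γ v) (clip γ (v - z))).trans
        (add_le_add (norm_clip_le hγ _) (norm_clip_le hγ _))
      linarith
  have h4 := mul_le_mul_of_nonneg_left (min_ratio_le (x := ‖z‖ / γ) hε)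
    (by positivity : 0 ≤ 2 * γ)
  linarith

end Clip

/-! ### Convexity of the objectives -/

section Objectives

variable {d : ℕ}

lemma sub_le_inner_gradient {g : Vec d → ℝ} (hc : ConvexOn ℝ Set.univ g) (hd : Differentiable ℝ g)
    (x y : Vec d) : g x - g y ≤ inner ℝ (gradient g x) (x - y) := by
  have hline : ConvexOn ℝ Set.univ fun s : ℝ => g (x + s • (y - x)) := by
    have := hc.comp_affineMap (AffineMap.lineMap x y : ℝ →ᵃ[ℝ] Vec d)
    simpa [Function.comp_def, AffineMap.lineMap_apply, add_comm] using this
  have hder : HasDerivAt (fun s : ℝ => g (x + s • (y - x))) (inner ℝ (gradient g x) (y - x)) 0 := by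
    have h1 : HasDerivAt (fun s : ℝ => x + s • (y - x)) (y - x) 0 := by
      simpa using ((hasDerivAt_id (0 : ℝ)).smul_const (y - x)).const_add x
    have h2 : HasFDerivAt g (fderiv ℝ g x) (x + (0 : ℝ) • (y - x)) := by
      simpa using (hd x).hasFDerivAt
    have := h2.comp_hasDerivAt (0 : ℝ) h1
    rwa [← inner_gradient_left] at this
  have := hline.le_slope_of_hasDerivAt (Set.mem_univ 0) (Set.mem_univ 1) one_pos hder
  rw [slope_def_field] at this
  simp only [one_smul, zero_smul, add_sub_cancel, add_zero, sub_zero, div_one] at this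
  rw [← neg_sub y x, inner_neg_right]
  linarith

lemma gradient_eq_zero_of_forall_le {g : Vec d → ℝ} {x : Vec d} (h : ∀ y, g x ≤ g y) :
    gradient g x = 0 := by
  have : IsLocalMin g x := .of_forall h
  rw [gradient, this.fderiv_eq_zero, map_zero]

variable {n : ℕ} {N : Finset (Fin n)} {f : Fin n → Vec d → ℝ} {L μ : ℝ} {xstar : Vec d}

lemma gradient_avgObjective (hd : ∀ i ∈ N, Differentiable ℝ (f i)) (x : Vec d) :
    gradient (avgObjective N f) x = (1 / (N.card : ℝ)) • ∑ i ∈ N, gradient (f i) x := by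
  refine HasGradientAt.gradient ?_
  rw [hasGradientAt_iff_hasFDerivAt]
  have h1 : HasFDerivAt (fun x => ∑ i ∈ N, f i x) (∑ i ∈ N, fderiv ℝ (f i) x) x :=
    HasFDerivAt.fun_sum fun i hi => (hd i hi x).hasFDerivAt
  have h2 := h1.const_mul (1 / (N.card : ℝ))
  have h3 : InnerProductSpace.toDual ℝ (Vec d)
      ((1 / (N.card : ℝ)) • ∑ i ∈ N, gradient (f i) x) =
      (1 / (N.card : ℝ)) • ∑ i ∈ N, fderiv ℝ (f i) x := by
    rw [map_smulₛₗ, map_sum]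
    simp_rw [toDual_gradient]
    rfl
  rw [h3]
  exact h2

/-- The gradients of the unattacked agents jointly point away from the common minimizer. -/
lemma card_mul_sq_le_sum_inner_gradient (hN : N.Nonempty)
    (hd : ∀ i ∈ N, Differentiable ℝ (f i)) (hstrong : IsStronglyConvex μ (avgObjective N f))
    (hmin : ∀ i ∈ N, ∀ y, f i xstar ≤ f i y) (x : Vec d) :
    N.card * μ * ‖x - xstar‖ ^ 2 ≤ ∑ i ∈ N, inner ℝ (gradient (f i) x) (x - xstar) := by
  have hc : (0 : ℝ) < N.card := by exact_mod_cast hN.card_pos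
  have h1 := hstrong x xstar
  have h2 := hstrong xstar x
  have h3 : gradient (avgObjective N f) xstar = 0 :=
    gradient_eq_zero_of_forall_le fun y => by
      unfold avgObjective
      exact mul_le_mul_of_nonneg_left (Finset.sum_le_sum fun i hi => hmin i hi y) (by positivity)
  rw [h3, inner_zero_left] at h2
  rw [gradient_avgObjective hd, inner_smul_left, sum_inner, conj_trivial] at h1
  have h4 : ∑ i ∈ N, inner ℝ (gradient (f i) x) (xstar - x) =
      -∑ i ∈ N, inner ℝ (gradient (f i) x) (x - xstar) := by
    rw [← Finset.sum_neg_distrib]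
    exact Finset.sum_congr rfl fun i _ => by rw [← inner_neg_right, neg_sub]
  rw [h4, norm_sub_rev xstar x] at h1
  have h5 : μ * ‖x - xstar‖ ^ 2 ≤
      1 / (N.card : ℝ) * ∑ i ∈ N, inner ℝ (gradient (f i) x) (x - xstar) := by linarith
  rw [one_div, ← div_eq_inv_mul, le_div_iff₀ hc] at h5
  linarith

end Objectives

/-! ### One descent step with a clipped minority of arbitrary directions -/

section Step

variable {n d : ℕ} {N : Finset (Fin n)} {L μ : ℝ}

/-- The square root lies below its tangent at `r ^ 2`. -/
lemma norm_le_of_sq_le {r s q ρ : ℝ} (hr : 0 < r) (h : ρ ^ 2 ≤ r ^ 2 - 2 * r * s + q) :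
    ρ ≤ r - s + q / (2 * r) := by
  have h0 : 0 ≤ r ^ 2 - 2 * r * s + q := (sq_nonneg ρ).trans h
  have h1 : r - s + q / (2 * r) = (r ^ 2 + (r ^ 2 - 2 * r * s + q)) / (2 * r) := by
    field_simp; ring
  have h2 : 0 ≤ r - s + q / (2 * r) := by rw [h1]; positivity
  refine le_of_sq_le_sq ?_ h2
  have h3 : (r - s + q / (2 * r)) ^ 2 = r ^ 2 - 2 * r * s + q + (s - q / (2 * r)) ^ 2 := by
    field_simp; ring
  rw [h3]
  nlinarith [sq_nonneg (s - q / (2 * r))]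

/-- One step with clipped directions, a minority of which is arbitrary, decreases the distance to
the minimizer as long as this distance is at least `γ / L`. -/
lemma norm_sub_smul_average_le (hn : 0 < n) (hL : 0 < L) {γ α : ℝ} (hγ : 0 < γ) (hα : 0 ≤ α)
    {g w : Fin n → Vec d} {u : Vec d} {e : Fin n → ℝ} (hu : γ / L ≤ ‖u‖)
    (hg0 : ∀ j ∈ N, 0 ≤ inner ℝ (g j) u) (hgL : ∀ j ∈ N, ‖g j‖ ≤ L * ‖u‖)
    (hsum : N.card * μ * ‖u‖ ^ 2 ≤ ∑ j ∈ N, inner ℝ (g j) u)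
    (hw : ∀ j, ‖w j‖ ≤ γ) (he : ∀ j ∈ N, ‖w j - clip γ (g j)‖ ≤ e j) :
    ‖u - α • average w‖ ≤ ‖u‖ - α * ((N.card * μ / L - (Nᶜ : Finset (Fin n)).card) / n * γ -
      (∑ j ∈ N, e j) / n) + α ^ 2 * γ * L / 2 := by
  have hn' : (0 : ℝ) < n := by exact_mod_cast hn
  have hr : 0 < ‖u‖ := lt_of_lt_of_le (by positivity) hu
  have hγL : γ ≤ L * ‖u‖ := by rwa [div_le_iff₀' hL] at hu
  -- Worst case for the attacked agents: each pushes straight away from the minimizer at full length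
  -- `γ`.
  have h1 : -((Nᶜ : Finset (Fin n)).card * (γ * ‖u‖)) ≤ ∑ j ∈ Nᶜ, inner ℝ (w j) u := by
    have : ∀ j ∈ Nᶜ, -(γ * ‖u‖) ≤ inner ℝ (w j) u := fun j _ => by
      have h2 := (abs_le.1 (abs_real_inner_le_norm (w j) u)).1
      have h3 := mul_le_mul_of_nonneg_right (hw j) hr.le
      linarith
    have := Finset.card_nsmul_le_sum _ _ _ this
    simpa using this
  have h2 : γ / (L * ‖u‖) * (N.card * μ * ‖u‖ ^ 2) - (∑ j ∈ N, e j) * ‖u‖ ≤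
      ∑ j ∈ N, inner ℝ (w j) u := by
    have : ∀ j ∈ N, γ / (L * ‖u‖) * inner ℝ (g j) u - e j * ‖u‖ ≤ inner ℝ (w j) u := by
      intro j hj
      have h3 := div_mul_inner_le_inner_clip hγ hγL (hgL j hj) (hg0 j hj)
      have h4 := (abs_le.1 (abs_real_inner_le_norm (w j - clip γ (g j)) u)).1
      have h5 := mul_le_mul_of_nonneg_right (he j hj) hr.le
      rw [inner_sub_left] at h4
      linarith
    have h6 := Finset.sum_le_sum this
    rw [Finset.sum_sub_distrib, ← Finset.mul_sum, ← Finset.sum_mul] at h6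
    have h7 := mul_le_mul_of_nonneg_left hsum (by positivity : 0 ≤ γ / (L * ‖u‖))
    linarith
  have h3 : γ / (L * ‖u‖) * (N.card * μ * ‖u‖ ^ 2) = N.card * μ / L * γ * ‖u‖ := by
    field_simp
  have h4 : inner ℝ (average w) u = (∑ j ∈ N, inner ℝ (w j) u + ∑ j ∈ Nᶜ, inner ℝ (w j) u) / n := by
    rw [Finset.sum_add_sum_compl, average, inner_smul_left, sum_inner, conj_trivial]
    field_simp
  set D := (N.card * μ / L - (Nᶜ : Finset (Fin n)).card) / n * γ - (∑ j ∈ N, e j) / n with hD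
  have h5 : ‖u‖ * D ≤ inner ℝ u (average w) := by
    rw [real_inner_comm, h4, le_div_iff₀ hn', hD]
    rw [h3] at h2
    have : ‖u‖ * ((N.card * μ / L - (Nᶜ : Finset (Fin n)).card) / n * γ - (∑ j ∈ N, e j) / n) * n =
      N.card * μ / L * γ * ‖u‖ - (∑ j ∈ N, e j) * ‖u‖ -
        (Nᶜ : Finset (Fin n)).card * (γ * ‖u‖) := by field_simp; ring
    linarith
  have h6 : ‖u - α • average w‖ ^ 2 ≤ ‖u‖ ^ 2 - 2 * ‖u‖ * (α * D) + α ^ 2 * γ ^ 2 := by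
    rw [norm_sub_sq_real, inner_smul_right, norm_smul, mul_pow, Real.norm_eq_abs, sq_abs]
    have h7 := pow_le_pow_left₀ (norm_nonneg _) (norm_average_le hn hw) 2
    have h8 := mul_le_mul_of_nonneg_left h7 (sq_nonneg α)
    have h9 := mul_le_mul_of_nonneg_left h5 hα
    linarith
  refine (norm_le_of_sq_le hr h6).trans ?_
  have h7 : α ^ 2 * γ ^ 2 / (2 * ‖u‖) ≤ α ^ 2 * γ * L / 2 := by
    rw [div_le_div_iff₀ (by positivity) two_pos]
    have := mul_le_mul_of_nonneg_left hγL (by positivity : 0 ≤ α ^ 2 * γ)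
    linarith
  linarith

end Step

/-! ### Identities and increments along a run -/

lemma ema_add {E : Type*} [AddCommGroup E] [Module ℝ E] (η : ℕ → ℝ) (a b : ℕ → E) (t : ℕ) :
    ema η (fun s => a s + b s) t = ema η a t + ema η b t := by
  induction t with
  | zero => rfl
  | succ t ih => simp only [ema, ih]; module

section Run

variable {n d : ℕ} {W : Matrix (Fin n) (Fin n) ℝ} {α γ η : ℕ → ℝ} {m x v : Fin n → ℕ → Vec d}

lemma IsRun.v_eq_ema (h : IsRun W α γ η m x v) (i : Fin n) (t : ℕ) : v i t = ema η (m i) t := by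
  induction t with
  | zero => exact h.v_zero i
  | succ t ih => rw [h.v_succ, ih]; rfl

lemma IsRun.x_succ_clip (h : IsRun W α γ η m x v) (i : Fin n) (t : ℕ) :
    x i (t + 1) = ∑ j, W i j • (x j t - α t • clip (γ t) (v j t)) := by
  simp_rw [h.x_succ, clip, smul_smul]

lemma IsRun.average_succ (h : IsRun W α γ η m x v) (hW : W ∈ doublyStochastic ℝ (Fin n)) (t : ℕ) :
    average (fun i => x i (t + 1)) =
      average (fun i => x i t) - α t • average (fun i => clip (γ t) (v i t)) := by
  simp_rw [h.x_succ_clip]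
  rw [average_mix hW, average_sub_smul]

lemma IsRun.disagreement_succ_le (h : IsRun W α γ η m x v) (hn : 0 < n)
    (hW : W ∈ doublyStochastic ℝ (Fin n)) {l : ℝ} (hl0 : 0 ≤ l)
    (hl : ∀ y : Fin n → ℝ, ∑ i, y i = 0 → ∑ i, (W.mulVec y i) ^ 2 ≤ l ^ 2 * ∑ i, (y i) ^ 2)
    (hα : ∀ t, 0 ≤ α t) (hγ : ∀ t, 0 < γ t) (t : ℕ) :
    disagreement (fun i => x i (t + 1)) ≤
      l * (disagreement (fun i => x i t) + α t * (√n * (2 * γ t))) := by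
  simp_rw [h.x_succ_clip]
  exact disagreement_step hn hW hl0 hl _ _ (hα t) fun i => norm_clip_le (hγ t) _

lemma IsRun.norm_succ_sub_le (h : IsRun W α γ η m x v) (hn : 0 < n)
    (hW : W ∈ doublyStochastic ℝ (Fin n)) (hα : ∀ t, 0 ≤ α t) (hγ : ∀ t, 0 < γ t)
    (i : Fin n) (t : ℕ) :
    ‖x i (t + 1) - x i t‖ ≤ disagreement (fun i => x i (t + 1)) +
      disagreement (fun i => x i t) + α t * γ t := by
  have h1 := norm_sub_average_le (fun i => x i (t + 1)) i
  have h2 := norm_sub_average_le (fun i => x i t) i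
  have h3 : ‖α t • average (fun i => clip (γ t) (v i t))‖ ≤ α t * γ t := by
    rw [norm_smul, Real.norm_eq_abs, abs_of_nonneg (hα t)]
    exact mul_le_mul_of_nonneg_left (norm_average_le hn fun i => norm_clip_le (hγ t) _) (hα t)
  have h4 : x i (t + 1) - x i t = (x i (t + 1) - average (fun i => x i (t + 1))) -
      (x i t - average (fun i => x i t)) - α t • average (fun i => clip (γ t) (v i t)) := by
    rw [h.average_succ hW]; abel
  rw [h4]
  refine (norm_sub_le _ _).trans (add_le_add ((norm_sub_le _ _).trans (add_le_add h1 h2)) h3)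

end Run

/-! ### Pathwise estimates: consensus, gradient tracking, descent -/

section Pathwise

variable {n d : ℕ} {G : SimpleGraph (Fin n)} {W : Matrix (Fin n) (Fin n) ℝ}
  {cα cγ cη τα τγ τη : ℝ} {φ : ℕ} {m x v : Fin n → ℕ → Vec d}

/-- Contraction at a fixed rate forgets the past faster than `α γ` decays, so the disagreement has
the order of its latest perturbation. -/
lemma IsRun.exists_disagreement_le
    (h : IsRun W (schedule cα φ τα) (schedule cγ φ τγ) (schedule cη φ τη) m x v)
    (hn : 0 < n) (hW : IsMixingMatrix G W) (hφ : 0 < φ) (hcα : 0 < cα) (hcγ : 0 < cγ)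
    (hτ : 0 ≤ τα + τγ) :
    ∃ C : ℝ, 0 ≤ C ∧ ∀ t, disagreement (fun i => x i t) ≤
      C * (schedule cα φ τα t * schedule cγ φ τγ t) := by
  obtain ⟨l, hl0, hl1, hl⟩ := hW.exists_contraction
  have hl1' : 0 < 1 - l := by linarith
  set A : ℝ := (2 * √n + 1) / (1 - l) with hA
  have hAp : 0 < A := by positivity
  have hpos : 0 < A * (cα * cγ) := by positivity
  have hslow : ∀ᶠ t : ℕ in atTop, (τα + τγ) / ((t : ℝ) + φ) ≤ (1 - l) / 2 :=
    (tendsto_const_div_shift _ φ).eventually (ge_mem_nhds (half_pos hl1'))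
  have hmul : ∀ t, schedule (A * (cα * cγ)) φ (τα + τγ) t =
      A * (schedule cα φ τα t * schedule cγ φ τγ t) := fun t => by
    rw [schedule_mul hφ]; unfold schedule; ring
  obtain ⟨C, hC0, hC⟩ := exists_le_mul_schedule (y := fun t => disagreement fun i => x i t)
    (l := fun _ => 1 - l) hpos hτ hφ (fun _ => ⟨hl1'.le, by linarith⟩) hslow (fun t => by
      have h1 := h.disagreement_succ_le hn hW.stochastic hl0 hl
        (fun t => (schedule_pos hcα hφ t).le) (schedule_pos hcγ hφ) t
      refine h1.trans ?_
      have h2 : 0 ≤ schedule cα φ τα t * schedule cγ φ τγ t :=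
        mul_nonneg (schedule_pos hcα hφ t).le (schedule_pos hcγ hφ t).le
      rw [hmul, ← mul_assoc (1 - l), hA, mul_div_cancel₀ _ hl1'.ne', sub_sub_cancel]
      have h3 : l * (2 * √n) ≤ 2 * √n + 1 := by nlinarith [Real.sqrt_nonneg (n : ℝ)]
      have h4 := mul_le_mul_of_nonneg_right h3 h2
      linarith)
  refine ⟨C * A, by positivity, fun t => ?_⟩
  rw [mul_assoc, ← hmul]
  exact hC t

/-- The averaged gradients track the current gradient. -/
lemma IsRun.exists_tracking_le
    (h : IsRun W (schedule cα φ τα) (schedule cγ φ τγ) (schedule cη φ τη) m x v)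
    (hn : 0 < n) (hW : IsMixingMatrix G W) (hφ : 0 < φ) (hcα : 0 < cα) (hcγ : 0 < cγ)
    (hcη : 0 < cη) (hτα : 0 < τα) (hτγ : 0 < τγ) (hη : ∀ t, schedule cη φ τη t ∈ Set.Ioo (0 : ℝ) 1)
    (hη1 : τη < 1) (hητ : τη < τα + τγ) {L : ℝ} (hL : 0 < L) {g : Vec d → ℝ} (hg : IsSmooth L g)
    (j : Fin n) :
    ∃ C : ℝ, 0 ≤ C ∧ ∀ t, ‖ema (schedule cη φ τη) (fun s => gradient g (x j s)) t -
      gradient g (average fun i => x i t)‖ ≤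
        C * (schedule cα φ τα t * schedule cγ φ τγ t / schedule cη φ τη t) := by
  obtain ⟨D, hD0, hD⟩ := h.exists_disagreement_le hn hW hφ hcα hcγ (by linarith)
  -- An agent moves by at most two disagreements, `2 D α γ`, plus the displacement `α γ` of the
  -- average.
  set B : ℝ := L * (2 * D + 1) with hB
  have hBp : 0 < B := by positivity
  set p : ℕ → ℝ := fun t => schedule cα φ τα t * schedule cγ φ τγ t with hp
  have hpp : ∀ t, 0 < p t := fun t => mul_pos (schedule_pos hcα hφ t) (schedule_pos hcγ hφ t)
  have hpanti : ∀ t, p (t + 1) ≤ p t := fun t => by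
    simp only [hp]
    rw [schedule_mul hφ, schedule_mul hφ]
    exact schedule_succ_le (by positivity) (by linarith) hφ t
  have hmul : ∀ t, schedule (B * (cα * cγ) / cη) φ (τα + τγ - τη) t =
      B * (p t / schedule cη φ τη t) := fun t => by
    simp only [hp]
    rw [schedule_mul hφ, schedule_div hφ]; unfold schedule; ring
  have hslow : ∀ᶠ t : ℕ in atTop, (τα + τγ - τη) / ((t : ℝ) + φ) ≤ schedule cη φ τη t / 2 := by
    filter_upwards [eventually_div_shift_le_schedule (τα + τγ - τη) hcη hη1 hφ one_half_pos]
      with t ht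
    linarith
  have hx : ∀ t, ‖x j (t + 1) - x j t‖ ≤ (2 * D + 1) * p t := fun t => by
    have h1 := h.norm_succ_sub_le hn hW.stochastic (fun t => (schedule_pos hcα hφ t).le)
      (schedule_pos hcγ hφ) j t
    have h2 := hD t
    have h3 := hD (t + 1)
    have h4 := mul_le_mul_of_nonneg_left (hpanti t) hD0
    simp only [hp] at h4 ⊢
    linarith
  obtain ⟨C, hC0, hC⟩ := exists_le_mul_schedule
    (y := fun t => ‖ema (schedule cη φ τη) (fun s => gradient g (x j s)) t - gradient g (x j t)‖)
    (l := schedule cη φ τη) (c := B * (cα * cγ) / cη) (a := τα + τγ - τη) (by positivity)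
    (by linarith) hφ (fun t => ⟨(hη t).1.le, (hη t).2.le⟩) hslow (fun t => by
      have hη0 := (hη t).1
      rw [hmul, mul_left_comm (schedule cη φ τη t), mul_div_cancel₀ _ hη0.ne']
      have h1 : ema (schedule cη φ τη) (fun s => gradient g (x j s)) (t + 1) -
          gradient g (x j (t + 1)) = (1 - schedule cη φ τη t) •
          (ema (schedule cη φ τη) (fun s => gradient g (x j s)) t - gradient g (x j t)) -
          (1 - schedule cη φ τη t) • (gradient g (x j (t + 1)) - gradient g (x j t)) := by
        simp only [ema]; module
      rw [h1]
      have h0 : 0 ≤ 1 - schedule cη φ τη t := by linarith [(hη t).2]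
      refine (norm_sub_le _ _).trans ?_
      rw [norm_smul, norm_smul, Real.norm_eq_abs, abs_of_nonneg h0]
      refine add_le_add le_rfl ?_
      calc (1 - schedule cη φ τη t) * ‖gradient g (x j (t + 1)) - gradient g (x j t)‖ ≤
            1 * (L * ‖x j (t + 1) - x j t‖) := by
            gcongr
            · linarith
            · exact hg _ _
        _ ≤ 1 * (L * ((2 * D + 1) * p t)) := by gcongr; exact hx t
        _ = _ := by rw [hB]; ring)
  refine ⟨C * B + L * D, by positivity, fun t => ?_⟩
  have h1 := hC t
  rw [hmul] at h1
  have h2 : ‖gradient g (x j t) - gradient g (average fun i => x i t)‖ ≤ L * (D * p t) := by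
    refine (hg _ _).trans ?_
    have := (norm_sub_average_le (fun i => x i t) j).trans (hD t)
    gcongr
  have h3 : p t ≤ p t / schedule cη φ τη t := by
    rw [le_div_iff₀ (hη t).1]
    nlinarith [hpp t, (hη t).2]
  have h4 := mul_le_mul_of_nonneg_left h3 (by positivity : 0 ≤ L * D)
  have h5 := norm_sub_le_norm_sub_add_norm_sub
    (ema (schedule cη φ τη) (fun s => gradient g (x j s)) t) (gradient g (x j t))
    (gradient g (average fun i => x i t))
  simp only [hp] at h1 h2 h4
  linarith

/-- The change of `γ` contributes `O(1 / t) = o(η)` since `τη < 1`; the variance contributes a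
multiple of `η` times `η / γ ^ 2`, which tends to 0 since `2 * τγ < τη`. -/
lemma eventually_driftCorrection_le (hφ : 0 < φ) (hcγ : 0 < cγ) (hcη : 0 < cη) (hτγ : 0 < τγ)
    (hη1 : τη < 1) (hηγ : 2 * τγ < τη) (σ : ℝ) {δ : ℝ} (hδ : 0 < δ) :
    ∀ᶠ t in atTop, driftCorrection (schedule cη φ τη) (schedule cγ φ τγ) σ t ≤
      δ * schedule cη φ τη t := by
  obtain ⟨K, hK⟩ := schedule_sq_ratio_le hcγ hτγ.le hφ
  have hlim := tendsto_schedule (4 * σ ^ 2 * (cη / (cγ * cγ))) φ (a := τη - (τγ + τγ)) (by linarith)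
  filter_upwards [hK, eventually_div_shift_le_schedule K hcη hη1 hφ (half_pos hδ),
    hlim.eventually (ge_mem_nhds (half_pos hδ)),
    eventually_half_le_schedule_succ hcγ.le hτγ.le hφ] with t h1 h2 h3 h4
  have hγ := schedule_pos (a := τγ) hcγ hφ t
  have hη := schedule_pos (a := τη) hcη hφ t
  have h5 : schedule (4 * σ ^ 2 * (cη / (cγ * cγ))) φ (τη - (τγ + τγ)) t =
      4 * σ ^ 2 * (schedule cη φ τη t / (schedule cγ φ τγ t * schedule cγ φ τγ t)) := by
    rw [schedule_mul hφ, schedule_div hφ]; unfold schedule; ring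
  rw [h5] at h3
  have h6 : schedule cη φ τη t ^ 2 * σ ^ 2 / schedule cγ φ τγ (t + 1) ^ 2 ≤
      schedule cη φ τη t ^ 2 * σ ^ 2 / (schedule cγ φ τγ t / 2) ^ 2 := by gcongr
  have h7 : schedule cη φ τη t ^ 2 * σ ^ 2 / (schedule cγ φ τγ t / 2) ^ 2 =
      (4 * σ ^ 2 * (schedule cη φ τη t / (schedule cγ φ τγ t * schedule cγ φ τγ t))) *
        schedule cη φ τη t := by field_simp; ring
  have h8 := mul_le_mul_of_nonneg_right h3 hη.le
  unfold driftCorrection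
  linarith

/-- At the unattacked agents, the estimator minus its noise part is close to the gradient at the
average iterate. -/
lemma IsRun.exists_tracking_forall_le
    (h : IsRun W (schedule cα φ τα) (schedule cγ φ τγ) (schedule cη φ τη) m x v)
    (hn : 0 < n) (hW : IsMixingMatrix G W) (hφ : 0 < φ) (hcα : 0 < cα) (hcγ : 0 < cγ)
    (hcη : 0 < cη) (hτα : 0 < τα) (hτγ : 0 < τγ) (hη : ∀ t, schedule cη φ τη t ∈ Set.Ioo (0 : ℝ) 1)
    (hη1 : τη < 1) (hητ : τη < τα + τγ) {N : Finset (Fin n)} {f : Fin n → Vec d → ℝ} {L : ℝ}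
    (hL : 0 < L) (hsmooth : ∀ i ∈ N, IsSmooth L (f i))
    {ξ : Fin n → ℕ → Vec d} (horacle : ∀ i ∈ N, ∀ t, m i t = gradient (f i) (x i t) + ξ i t) :
    ∃ C : ℝ, 0 ≤ C ∧ ∀ j ∈ N, ∀ t, ‖v j t - ema (schedule cη φ τη) (ξ j) t -
      gradient (f j) (average fun i => x i t)‖ ≤
        C * (schedule cα φ τα t * schedule cγ φ τγ t / schedule cη φ τη t) := by
  have h1 : ∀ j, ∃ C : ℝ, 0 ≤ C ∧ (j ∈ N → ∀ t, ‖v j t - ema (schedule cη φ τη) (ξ j) t -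
    gradient (f j) (average fun i => x i t)‖ ≤
      C * (schedule cα φ τα t * schedule cγ φ τγ t / schedule cη φ τη t)) := by
    intro j
    by_cases hj : j ∈ N
    · obtain ⟨C, hC0, hC⟩ := h.exists_tracking_le hn hW hφ hcα hcγ hcη hτα hτγ hη hη1 hητ hL
        (hsmooth j hj) j
      refine ⟨C, hC0, fun _ t => ?_⟩
      have h2 : v j t = ema (schedule cη φ τη) (fun s => gradient (f j) (x j s)) t +
          ema (schedule cη φ τη) (ξ j) t := by
        rw [h.v_eq_ema, ← ema_add]
        congr 1
        exact funext fun s => horacle j hj s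
      rw [h2, add_sub_cancel_right]
      exact hC t
    · exact ⟨0, le_rfl, fun h => absurd h hj⟩
  choose C hC0 hC using h1
  refine ⟨∑ j, C j, Finset.sum_nonneg fun j _ => hC0 j, fun j hj t => (hC j hj t).trans ?_⟩
  have h3 := Finset.single_le_sum (f := C) (fun j _ => hC0 j) (Finset.mem_univ j)
  have := schedule_pos (a := τα) hcα hφ t
  have := schedule_pos (a := τγ) hcγ hφ t
  have := schedule_pos (a := τη) hcη hφ t
  gcongr

/-- One step of the descent, with the clipping errors expressed by saturated noise energies `s`. -/
lemma norm_sub_smul_average_le_of_noise {N : Finset (Fin n)} {L μ : ℝ} (hn : 0 < n) (hL : 0 < L)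
    {γ α η b C ε c₀ Q δ e : ℝ} (hγt : 0 < γ) (hαt : 0 < α) (hbp : 0 < b) (hC0 : 0 ≤ C)
    (hbη : b * η = α * γ) (hc₀ : c₀ = (N.card * μ / L - (Nᶜ : Finset (Fin n)).card) / n)
    (hε : ε = c₀ / 16) (hεp : 0 < ε) (hQ : Q = 2 * ((1 + ε ^ 2) / ε ^ 2))
    {g w : Fin n → Vec d} {u : Vec d} {s : Fin n → ℝ} (hs0 : ∀ j, 0 ≤ s j) (hu : γ / L ≤ ‖u‖)
    (hg0 : ∀ j ∈ N, 0 ≤ inner ℝ (g j) u) (hgL : ∀ j ∈ N, ‖g j‖ ≤ L * ‖u‖)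
    (hsum : N.card * μ * ‖u‖ ^ 2 ≤ ∑ j ∈ N, inner ℝ (g j) u)
    (hw : ∀ j, ‖w j‖ ≤ γ) (he : ∀ j ∈ N, ‖w j - clip γ (g j)‖ ≤
      2 * γ * (ε + (1 + ε ^ 2) / ε ^ 2 * s j) + 2 * (C * b))
    (hpot : η * ∑ j ∈ N, s j ≤ δ + N.card * e)
    (h1 : 2 * C * b ≤ c₀ / 8 * γ) (h2 : α * L / 2 ≤ c₀ / 8)
    (h3 : Q * (N.card * e) ≤ c₀ / 8 * η) :
    ‖u - α • average w‖ ≤ ‖u‖ - c₀ / 2 * (α * γ) + Q * b * δ := by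
  have hn' : (0 : ℝ) < n := by exact_mod_cast hn
  have hn1 : (1 : ℝ) ≤ n := by exact_mod_cast hn
  have hNn : (N.card : ℝ) ≤ n := by
    have := Finset.card_le_univ N
    rw [Fintype.card_fin] at this
    exact_mod_cast this
  have hQp : 0 < Q := by rw [hQ]; positivity
  have hstep := norm_sub_smul_average_le hn hL hγt hαt.le hu hg0 hgL hsum hw he
  rw [← hc₀] at hstep
  have hse : ∑ j ∈ N, (2 * γ * (ε + (1 + ε ^ 2) / ε ^ 2 * s j) + 2 * (C * b)) =
      N.card * (2 * γ * ε + 2 * (C * b)) + Q * γ * ∑ j ∈ N, s j := by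
    rw [Finset.mul_sum, ← nsmul_eq_mul, ← Finset.sum_const, ← Finset.sum_add_distrib]
    refine Finset.sum_congr rfl fun j _ => ?_
    rw [hQ]; ring
  have hss : 0 ≤ ∑ j ∈ N, s j := Finset.sum_nonneg fun j _ => hs0 j
  have hse2 : (∑ j ∈ N, (2 * γ * (ε + (1 + ε ^ 2) / ε ^ 2 * s j) + 2 * (C * b))) / n ≤
      (2 * γ * ε + 2 * (C * b)) + Q * γ * ∑ j ∈ N, s j := by
    rw [hse, div_le_iff₀ hn']
    have h5 : 0 ≤ 2 * γ * ε + 2 * (C * b) := by positivity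
    have h6 : 0 ≤ Q * γ * ∑ j ∈ N, s j := by positivity
    nlinarith
  have hq1 : α * (Q * γ * ∑ j ∈ N, s j) ≤ Q * b * (δ) +
      c₀ / 8 * (α * γ) := by
    have h5 := mul_le_mul_of_nonneg_left hpot (by positivity : 0 ≤ Q * b)
    have h6 := mul_le_mul_of_nonneg_left h3 hbp.le
    have h7 : α * (Q * γ * ∑ j ∈ N, s j) = Q * b * (η * ∑ j ∈ N, s j) := by
      have : α * (Q * γ * ∑ j ∈ N, s j) = Q * (α * γ) * ∑ j ∈ N, s j := by ring
      rw [this, ← hbη]; ring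
    have h8 : b * (c₀ / 8 * η) = c₀ / 8 * (α * γ) := by rw [← hbη]; ring
    rw [h7]
    linarith
  have hq2 := mul_le_mul_of_nonneg_left hse2 hαt.le
  have hq3 := mul_le_mul_of_nonneg_left h1 hαt.le
  have hq4 := mul_le_mul_of_nonneg_left h2 (by positivity : 0 ≤ α * γ)
  have hq5 : α * (2 * γ * ε) = c₀ / 8 * (α * γ) := by rw [hε]; ring
  linarith

/-- Distance of the average iterate to the minimizer along one trajectory, given potentials which
dominate the saturated noise energy. -/
lemma IsRun.eventually_norm_average_sub_le
    (h : IsRun W (schedule cα φ τα) (schedule cγ φ τγ) (schedule cη φ τη) m x v)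
    (hn : 0 < n) (hW : IsMixingMatrix G W) (hφ : 0 < φ) (hcα : 0 < cα) (hcγ : 0 < cγ)
    (hcη : 0 < cη) (hτα : 0 < τα) (hτγ : 0 < τγ) (hα : ∀ t, schedule cα φ τα t ∈ Set.Ioo (0 : ℝ) 1)
    (hη : ∀ t, schedule cη φ τη t ∈ Set.Ioo (0 : ℝ) 1)
    (hη1 : τη < 1) (hsum : τα + τγ < 1) (hητ : τη < τα + τγ) (hηγ : 2 * τγ < τη) (hηα : τη < τα)
    {N : Finset (Fin n)} {f : Fin n → Vec d → ℝ} {L μ : ℝ} {xstar : Vec d} (hN : N.Nonempty)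
    (hL : 0 < L) (hsmooth : ∀ i ∈ N, IsSmooth L (f i))
    (hconvex : ∀ i ∈ N, ConvexOn ℝ Set.univ (f i)) (hdiff : ∀ i ∈ N, Differentiable ℝ (f i))
    (hstrong : IsStronglyConvex μ (avgObjective N f))
    (hmin : ∀ i ∈ N, ∀ y, f i xstar ≤ f i y)
    (hρ : ((Nᶜ : Finset (Fin n)).card : ℝ) < N.card * μ / L)
    {ξ : Fin n → ℕ → Vec d} (horacle : ∀ i ∈ N, ∀ t, m i t = gradient (f i) (x i t) + ξ i t)
    {σ : ℝ} {H : Fin n → ℕ → ℝ} (hH0 : ∀ i t, 0 ≤ H i t)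
    (hH : ∀ i ∈ N, ∀ t, H i t + noiseIncrement (schedule cη φ τη) (schedule cγ φ τγ) σ
      (ema (schedule cη φ τη) (ξ i)) t ≤ H i (t + 1))
    (hHlog : ∀ i ∈ N, ∀ᶠ t : ℕ in atTop, H i t ≤ 4 * Real.log ((t : ℝ) + 1)) :
    ∃ M K : ℝ, ∀ᶠ t : ℕ in atTop, ‖average (fun i => x i t) - xstar‖ ≤
      M * schedule cγ φ τγ t + K * ((schedule cα φ τα t * schedule cγ φ τγ t /
        schedule cη φ τη t) * Real.log ((t : ℝ) + 1)) := by
  have hn' : (0 : ℝ) < n := by exact_mod_cast hn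
  set c₀ : ℝ := (N.card * μ / L - (Nᶜ : Finset (Fin n)).card) / n with hc₀
  have hc₀p : 0 < c₀ := div_pos (sub_pos.2 hρ) hn'
  -- Four errors, from `ε`, the tracking lag, the second-order term and the drift correction, may
  -- each consume `c₀ / 8` of the drift `c₀ α γ`, leaving half of it.
  set ε : ℝ := c₀ / 16 with hε
  have hεp : 0 < ε := by positivity
  set Q : ℝ := 2 * ((1 + ε ^ 2) / ε ^ 2) with hQ
  have hQp : 0 < Q := by positivity
  have hαp : ∀ t, 0 < schedule cα φ τα t := schedule_pos hcα hφ
  have hγp : ∀ t, 0 < schedule cγ φ τγ t := schedule_pos hcγ hφ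
  have hηp : ∀ t, 0 < schedule cη φ τη t := schedule_pos hcη hφ
  obtain ⟨C, hC0, hC⟩ := h.exists_tracking_forall_le hn hW hφ hcα hcγ hcη hτα hτγ hη hη1 hητ hL
    hsmooth horacle
  set r : ℕ → ℝ := fun t => ‖average (fun i => x i t) - xstar‖ with hr
  set Htot : ℕ → ℝ := fun t => ∑ j ∈ N, H j t with hHtot
  have hlogtot : ∀ᶠ t : ℕ in atTop, Htot t ≤ (4 * N.card) * Real.log ((t : ℝ) + 1) := by
    have h1 : ∀ᶠ t : ℕ in atTop, ∀ i ∈ N, H i t ≤ 4 * Real.log ((t : ℝ) + 1) :=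
      (Filter.eventually_all_finset N).2 hHlog
    filter_upwards [h1] with t ht
    refine (Finset.sum_le_card_nsmul _ _ _ ht).trans (le_of_eq ?_)
    rw [nsmul_eq_mul]; ring
  have hb : ∀ᶠ t in atTop, 2 * C * (schedule cα φ τα t * schedule cγ φ τγ t / schedule cη φ τη t) ≤
      c₀ / 8 * schedule cγ φ τγ t := by
    have hlim := tendsto_schedule (2 * C * (cα / cη)) φ (a := τα - τη) (by linarith)
    filter_upwards [hlim.eventually (ge_mem_nhds (show 0 < c₀ / 8 by positivity))] with t ht
    have h1 : schedule (2 * C * (cα / cη)) φ (τα - τη) t =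
        2 * C * (schedule cα φ τα t / schedule cη φ τη t) := by
      rw [schedule_div hφ]; unfold schedule; ring
    rw [h1] at ht
    have := mul_le_mul_of_nonneg_right ht (hγp t).le
    refine le_trans (le_of_eq ?_) this
    ring
  have hαsmall : ∀ᶠ t in atTop, schedule cα φ τα t * L / 2 ≤ c₀ / 8 := by
    have hlim := tendsto_schedule cα φ hτα
    filter_upwards [hlim.eventually (ge_mem_nhds (show 0 < c₀ / (4 * L) by positivity))] with t ht
    rw [le_div_iff₀ (by positivity)] at ht
    linarith
  have hdrift : ∀ᶠ t in atTop, Q * (N.card *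
      driftCorrection (schedule cη φ τη) (schedule cγ φ τγ) σ t) ≤ c₀ / 8 * schedule cη φ τη t := by
    have hNp : (0 : ℝ) < N.card := by exact_mod_cast hN.card_pos
    filter_upwards [eventually_driftCorrection_le hφ hcγ hcη hτγ hη1 hηγ σ
      (show 0 < c₀ / 8 / (Q * N.card) by positivity)] with t ht
    have := mul_le_mul_of_nonneg_left ht (by positivity : 0 ≤ Q * N.card)
    refine le_trans (le_of_eq (by ring)) (this.trans (le_of_eq ?_))
    field_simp
  have hdesc : ∀ᶠ t in atTop, schedule cγ φ τγ t / L ≤ r t →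
      r (t + 1) ≤ r t - c₀ / 2 * (schedule cα φ τα t * schedule cγ φ τγ t) +
        Q * (schedule cα φ τα t * schedule cγ φ τγ t / schedule cη φ τη t) *
          (Htot (t + 1) - Htot t) := by
    filter_upwards [hb, hαsmall, hdrift] with t h1 h2 h3 h4
    have hαt := hαp t
    have hγt := hγp t
    have hηt := hηp t
    set α := schedule cα φ τα t
    set γ := schedule cγ φ τγ t with hγdef
    set η := schedule cη φ τη t with hηdef
    set b := α * γ / η with hbdef
    have hbp : 0 < b := by positivity
    have hbη : b * η = α * γ := by rw [hbdef]; field_simp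
    set e := driftCorrection (schedule cη φ τη) (schedule cγ φ τγ) σ t with hedef
    set s : Fin n → ℝ := fun j => (‖ema (schedule cη φ τη) (ξ j) t‖ / γ) ^ 2 /
      (1 + (‖ema (schedule cη φ τη) (ξ j) t‖ / γ) ^ 2) with hs
    have hs0 : ∀ j, 0 ≤ s j := fun j => by simp only [hs]; positivity
    have hstep := norm_sub_smul_average_le_of_noise (N := N) (μ := μ) (δ := Htot (t + 1) - Htot t)
      (e := e) hn hL hγt hαt hbp hC0 hbη hc₀ hε hεp hQ hs0 (w := fun j => clip γ (v j t))
      (g := fun j => gradient (f j) (average fun i => x i t))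
      (u := average (fun i => x i t) - xstar) h4
      (fun j hj => (sub_nonneg.2 (hmin j hj _)).trans
        (sub_le_inner_gradient (hconvex j hj) (hdiff j hj) _ _))
      (fun j hj => by
        have := hsmooth j hj (average fun i => x i t) xstar
        rwa [gradient_eq_zero_of_forall_le (hmin j hj), sub_zero] at this)
      (card_mul_sq_le_sum_inner_gradient hN hdiff hstrong hmin _)
      (fun j => norm_clip_le hγt _)
      (fun j hj => (norm_clip_sub_clip_le_noise hγt hεp _
        (ema (schedule cη φ τη) (ξ j) t) _).trans
          (add_le_add le_rfl (mul_le_mul_of_nonneg_left (hC j hj t) two_pos.le)))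
    have hx : average (fun i => x i t) - xstar - α • average (fun j => clip γ (v j t)) =
        average (fun i => x i (t + 1)) - xstar := by
      rw [h.average_succ hW.stochastic]; abel
    rw [hx] at hstep
    have hpot : η * ∑ j ∈ N, s j ≤ Htot (t + 1) - Htot t + N.card * e := by
      have h5 : ∑ j ∈ N, (η * s j - e) ≤ ∑ j ∈ N, (H j (t + 1) - H j t) := by
        refine Finset.sum_le_sum fun j hj => ?_
        have h6 := hH j hj t
        unfold noiseIncrement at h6
        rw [← hγdef, ← hηdef, ← hedef] at h6
        simp only [hs]
        linarith
      rw [Finset.sum_sub_distrib, Finset.sum_sub_distrib, ← Finset.mul_sum, Finset.sum_const,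
        nsmul_eq_mul] at h5
      simp only [hHtot]
      linarith
    exact hstep hpot h1 h2 h3
  have hnear : ∀ᶠ t in atTop, r t < schedule cγ φ τγ t / L →
      r (t + 1) ≤ r t + schedule cα φ τα t * schedule cγ φ τγ t := by
    refine .of_forall fun t _ => ?_
    have hx : average (fun i => x i (t + 1)) - xstar = average (fun i => x i t) - xstar -
        schedule cα φ τα t • average (fun j => clip (schedule cγ φ τγ t) (v j t)) := by
      rw [h.average_succ hW.stochastic]; abel
    simp only [hr]
    rw [hx]
    refine (norm_sub_le _ _).trans (add_le_add le_rfl ?_)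
    rw [norm_smul, Real.norm_eq_abs, abs_of_pos (hαp t)]
    exact mul_le_mul_of_nonneg_left (norm_average_le hn fun i => norm_clip_le (hγp t) _) (hαp t).le
  obtain ⟨M, hM⟩ := eventually_le_of_descent hφ hcα hcγ hcη hτα hτγ hη1 hsum hητ
    (half_pos hc₀p) hQp.le hL (fun t => (hα t).2)
    (fun t => Finset.sum_nonneg fun j _ => hH0 j t) hlogtot hdesc hnear
  refine ⟨M, Q * (4 * N.card), ?_⟩
  filter_upwards [hM] with t ht
  refine ht.trans (le_of_eq ?_)
  ring

end Pathwise

/-! ### From the pathwise bound to the rate -/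

lemma tendsto_rpow_mul_of_eventually_le {cα cγ cη τα τγ τη τ M K D : ℝ} {φ : ℕ} (hφ : 0 < φ)
    (hτ : 0 < τ) (hτγ : τ < τγ) (hτα : 0 < τα) (hητ : τη < τα) {y : ℕ → ℝ} (hy : ∀ t, 0 ≤ y t)
    (h : ∀ᶠ t : ℕ in atTop, y t ≤ M * schedule cγ φ τγ t +
      K * ((schedule cα φ τα t * schedule cγ φ τγ t / schedule cη φ τη t) *
        Real.log ((t : ℝ) + 2)) + D * (schedule cα φ τα t * schedule cγ φ τγ t)) :
    Tendsto (fun t : ℕ => ((t : ℝ) + 1) ^ τ * y t) atTop (𝓝 0) := by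
  have h1 := (tendsto_schedule (1 * cγ) φ (a := -τ + τγ) (by linarith)).const_mul M
  have h2 := (tendsto_log_mul_schedule (1 * (cα * cγ / cη)) hφ (a := -τ + (τα + τγ - τη))
    (by linarith)).const_mul K
  have h3 := (tendsto_schedule (1 * (cα * cγ)) φ (a := -τ + (τα + τγ)) (by linarith)).const_mul D
  have h4 := (h1.add h2).add h3
  simp only [mul_zero, add_zero] at h4
  refine squeeze_zero' (.of_forall fun t => mul_nonneg (by positivity) (hy t)) ?_ h4
  filter_upwards [h] with t ht
  have h5 : ((t : ℝ) + 1) ^ τ ≤ schedule 1 φ (-τ) t := by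
    have : (1 : ℝ) ≤ φ := by exact_mod_cast hφ
    unfold schedule
    rw [neg_neg, one_mul]
    gcongr
  have h6 : 0 ≤ schedule 1 φ (-τ) t := le_trans (by positivity) h5
  refine (mul_le_mul h5 ht (hy t) h6).trans (le_of_eq ?_)
  rw [← schedule_mul hφ, ← schedule_mul hφ, ← schedule_div hφ, ← schedule_mul hφ, ← schedule_mul hφ,
    ← schedule_mul hφ]
  ring

/-! ### Consequences of strong convexity and of the bound on attacked agents -/

section Nondegenerate

variable {n d : ℕ} {N : Finset (Fin n)} {f : Fin n → Vec d → ℝ} {L μ : ℝ} {xstar e : Vec d}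

lemma nonempty_of_isStronglyConvex (hμ : 0 < μ) (he : e ≠ 0)
    (hstrong : IsStronglyConvex μ (avgObjective N f)) : N.Nonempty := by
  by_contra hN
  rw [Finset.not_nonempty_iff_eq_empty] at hN
  have h0 : avgObjective N f = fun _ => 0 := by
    funext x; simp [avgObjective, hN]
  have h1 := hstrong 0 e
  rw [h0, gradient_fun_const] at h1
  simp only [inner_zero_left, sub_zero, add_zero, zero_add] at h1
  have : 0 < ‖e‖ := norm_pos_iff.2 he
  have : 0 < μ / 2 * ‖e‖ ^ 2 := by positivity
  linarith

/-- Comparing both bounds on the gradients at `xstar + e`, with `e ≠ 0`, yields the inequality; it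
supplies `0 < L`. -/
lemma le_of_isSmooth_of_isStronglyConvex (he : e ≠ 0) (hN : N.Nonempty)
    (hsmooth : ∀ i ∈ N, IsSmooth L (f i)) (hd : ∀ i ∈ N, Differentiable ℝ (f i))
    (hstrong : IsStronglyConvex μ (avgObjective N f))
    (hmin : ∀ i ∈ N, ∀ y, f i xstar ≤ f i y) : μ ≤ L := by
  have h1 := card_mul_sq_le_sum_inner_gradient hN hd hstrong hmin (xstar + e)
  have h2 : ∀ i ∈ N, inner ℝ (gradient (f i) (xstar + e)) (xstar + e - xstar) ≤ L * ‖e‖ ^ 2 := by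
    intro i hi
    have h3 := hsmooth i hi (xstar + e) xstar
    rw [gradient_eq_zero_of_forall_le (hmin i hi), sub_zero, add_sub_cancel_left] at h3
    rw [add_sub_cancel_left]
    have h4 := real_inner_le_norm (gradient (f i) (xstar + e)) e
    have h5 := mul_le_mul_of_nonneg_right h3 (norm_nonneg e)
    linarith
  have h6 := Finset.sum_le_card_nsmul _ _ _ h2
  rw [add_sub_cancel_left] at h1 h6
  rw [nsmul_eq_mul, ← mul_assoc] at h6
  have h7 : (0 : ℝ) < N.card * ‖e‖ ^ 2 := by
    have : (0 : ℝ) < N.card := by exact_mod_cast hN.card_pos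
    have : 0 < ‖e‖ := norm_pos_iff.2 he
    positivity
  have h8 := h1.trans h6
  by_contra hlt
  push Not at hlt
  nlinarith

/-- Clearing denominators, `ρ < 1 / (1 + κ)` reads `|A| κ < |N|`: the net drift is positive. -/
lemma card_compl_lt (hn : 0 < n) (hL : 0 < L) (hμ : 0 < μ)
    (hρ : attackedFraction N < 1 / (1 + L / μ)) :
    ((Nᶜ : Finset (Fin n)).card : ℝ) < N.card * μ / L := by
  have hn' : (0 : ℝ) < n := by exact_mod_cast hn
  have hκ : 0 < L / μ := by positivity
  have hcard : (N.card : ℝ) + (Nᶜ : Finset (Fin n)).card = n := by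
    have := Finset.card_add_card_compl N
    rw [Fintype.card_fin] at this
    exact_mod_cast this
  unfold attackedFraction at hρ
  rw [div_lt_div_iff₀ hn' (by positivity), one_mul, ← hcard] at hρ
  have h1 : ((Nᶜ : Finset (Fin n)).card : ℝ) * (L / μ) < N.card := by linarith
  rw [← mul_div_assoc, div_lt_iff₀ hμ] at h1
  rwa [lt_div_iff₀ hL]

end Nondegenerate

lemma one_div_schedule_sq_le {c a : ℝ} {φ : ℕ} (hc : 0 < c) (hφ : 0 < φ) (ha : 2 * a ≤ 1) (t : ℕ) :
    1 / (schedule c φ a t) ^ 2 ≤ φ / c ^ 2 * ((t : ℝ) + 1) := by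
  have hs := one_le_shift hφ t
  have hφ1 : (1 : ℝ) ≤ φ := by exact_mod_cast hφ
  have h0 : (0 : ℝ) < (t : ℝ) + φ := by linarith
  have h1 : 1 / (schedule c φ a t) ^ 2 = ((t : ℝ) + φ) ^ (2 * a) / c ^ 2 := by
    unfold schedule
    rw [mul_pow, ← Real.rpow_natCast (((t : ℝ) + φ) ^ (-a)) 2, ← Real.rpow_mul h0.le]
    have : -a * ((2 : ℕ) : ℝ) = -(2 * a) := by push_cast; ring
    rw [this, Real.rpow_neg h0.le]
    field_simp
  have h2 : ((t : ℝ) + φ) ^ (2 * a) ≤ (t : ℝ) + φ := by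
    calc _ ≤ ((t : ℝ) + φ) ^ (1 : ℝ) := Real.rpow_le_rpow_of_exponent_le hs ha
      _ = _ := Real.rpow_one _
  have h3 : (t : ℝ) + φ ≤ φ * ((t : ℝ) + 1) := by
    have : (0 : ℝ) ≤ t := Nat.cast_nonneg t
    nlinarith
  rw [h1, div_mul_eq_mul_div]
  gcongr
  linarith

end ClipVRG

end

/-! ### Assembly of the almost sure limit -/

theorem theorem1 {n d : ℕ} {Ω : Type*} [MeasurableSpace Ω]
    (P : Measure Ω) [IsProbabilityMeasure P]
    -- `N` is the set of unattacked agents; its complement is the set of attacked agents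
    (N : Finset (Fin n))
    -- objectives of the unattacked agents
    (f : Fin n → ClipVRG.Vec d → ℝ) (L μ : ℝ) (xstar : ClipVRG.Vec d)
    (hsmooth : ∀ i ∈ N, ClipVRG.IsSmooth L (f i))
    (hconvex : ∀ i ∈ N, ConvexOn ℝ Set.univ (f i))
    (hdiff : ∀ i ∈ N, ClipVRG.TwiceDifferentiable (f i))
    (hμ : 0 < μ)
    (hstrong : ClipVRG.IsStronglyConvex μ (ClipVRG.avgObjective N f))
    (hmin : ∀ i ∈ N, ∀ y, f i xstar ≤ f i y)
    -- network
    (G : SimpleGraph (Fin n)) (hG : G.Connected)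
    (W : Matrix (Fin n) (Fin n) ℝ) (hW : ClipVRG.IsMixingMatrix G W)
    -- the fraction of attacked agents is below `1 / (1 + κ)` with `κ = L / μ`
    (hρ : ClipVRG.attackedFraction N < 1 / (1 + L / μ))
    -- parameters
    (cα cγ cη τα τγ τη : ℝ) (φ : ℕ) (hφ : 0 < φ)
    (hcα : 0 < cα) (hcγ : 0 < cγ) (hcη : 0 < cη) (hτγ : 0 < τγ)
    (hα : ∀ t, ClipVRG.schedule cα φ τα t ∈ Set.Ioo (0 : ℝ) 1)
    (hγ : ∀ t, ClipVRG.schedule cγ φ τγ t ∈ Set.Ioo (0 : ℝ) 1)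
    (hη : ∀ t, ClipVRG.schedule cη φ τη t ∈ Set.Ioo (0 : ℝ) 1)
    (hτη : τη = 2 * (τα + τγ) / 3)
    (hτ₁ : 2 * τγ < τα) (hτ₂ : τα < min 1 (1 - τγ))
    -- noise, oracle outputs `m` (arbitrary at attacked agents), and the iterates
    (σ : ℝ) (ξ : Fin n → ℕ → Ω → ClipVRG.Vec d) (hξ : ClipVRG.IsNoise P N σ ξ)
    (m x v : Fin n → ℕ → Ω → ClipVRG.Vec d)
    (horacle : ∀ᵐ ω ∂P, ∀ i ∈ N, ∀ t, m i t ω = gradient (f i) (x i t ω) + ξ i t ω)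
    (hrun : ∀ᵐ ω ∂P, ClipVRG.IsRun W (ClipVRG.schedule cα φ τα) (ClipVRG.schedule cγ φ τγ)
      (ClipVRG.schedule cη φ τη)
      (fun i t => m i t ω) (fun i t => x i t ω) (fun i t => v i t ω)) :
    ∀ i : Fin n, ∀ τ : ℝ, 0 < τ → τ < min τγ ((τα - 2 * τγ) / 3) →
      ∀ᵐ ω ∂P, Tendsto (fun t : ℕ => ((t : ℝ) + 1) ^ τ * ‖x i t ω - xstar‖) atTop (𝓝 0) := by
  intro i τ hτ hττ
  -- In dimension 0 strong convexity is vacuous and gives neither an unattacked agent nor `0 < L`;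
  -- the claim is then trivial.
  rcases Nat.eq_zero_or_pos d with rfl | hd
  · refine .of_forall fun ω => ?_
    have : ∀ t, x i t ω - xstar = 0 := fun t => Subsingleton.elim _ _
    simp [this]
  have hn : 0 < n := i.pos
  have hdiff' : ∀ i ∈ N, Differentiable ℝ (f i) := fun i hi => (hdiff i hi).1
  have he : (EuclideanSpace.single (⟨0, hd⟩ : Fin d) (1 : ℝ)) ≠ 0 := by simp
  have hN := ClipVRG.nonempty_of_isStronglyConvex hμ he hstrong
  have hL : 0 < L := hμ.trans_le
    (ClipVRG.le_of_isSmooth_of_isStronglyConvex he hN hsmooth hdiff' hstrong hmin)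
  have hτα : 0 < τα := by linarith
  have hsum : τα + τγ < 1 := by have := lt_of_lt_of_le hτ₂ (min_le_right _ _); linarith
  have hτγ' : τ < τγ := lt_of_lt_of_le hττ (min_le_left _ _)
  -- Attacked agents receive the zero potential, so that a potential can be chosen for every index.
  have hpot : ∀ᵐ ω ∂P, ∀ j, ∃ H : ℕ → ℝ, (∀ t, 0 ≤ H t) ∧
      (j ∈ N → ∀ t, H t + ClipVRG.noiseIncrement (ClipVRG.schedule cη φ τη)
        (ClipVRG.schedule cγ φ τγ) σ
        (ClipVRG.ema (ClipVRG.schedule cη φ τη) fun s => ξ j s ω) t ≤ H (t + 1)) ∧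
      (j ∈ N → ∀ᶠ t : ℕ in atTop, H t ≤ 4 * Real.log ((t : ℝ) + 1)) := by
    refine ae_all_iff.2 fun j => ?_
    by_cases hj : j ∈ N
    · have hind : iIndepFun (ξ j) P := hξ.indep.precomp
        (g := fun t : ℕ => ((⟨j, hj⟩, t) : {i : Fin n // i ∈ N} × ℕ))
        (fun a b hab => (Prod.ext_iff.1 hab).2)
      filter_upwards [ClipVRG.ae_exists_potential hη (fun t => (hγ t).1)
        (ClipVRG.schedule_succ_le hcγ.le hτγ.le hφ)
        (ClipVRG.one_div_schedule_sq_le hcγ hφ (by linarith)) hind (hξ.memLp j hj)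
        (hξ.mean_zero j hj) (hξ.second_moment j hj)] with ω hω
      obtain ⟨H, h0, h1, h2⟩ := hω
      exact ⟨H, h0, fun _ => h1, fun _ => h2⟩
    · exact .of_forall fun ω => ⟨fun _ => 0, fun _ => le_rfl, fun h => absurd h hj,
        fun h => absurd h hj⟩
  filter_upwards [horacle, hrun, hpot] with ω hor hr hH
  choose H hH0 hH1 hH2 using hH
  obtain ⟨M, K, hMK⟩ := hr.eventually_norm_average_sub_le hn hW hφ hcα hcγ hcη hτα hτγ hα hη
    (by linarith) hsum (by linarith) (by linarith) (by linarith) hN hL hsmooth hconvex hdiff'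
    hstrong hmin (ClipVRG.card_compl_lt hn hL hμ hρ) hor hH0 hH1 hH2
  obtain ⟨D, -, hD⟩ := hr.exists_disagreement_le hn hW hφ hcα hcγ (by linarith)
  refine ClipVRG.tendsto_rpow_mul_of_eventually_le (cα := cα) (cγ := cγ) (cη := cη) (τα := τα)
    (τγ := τγ) (τη := τη) (M := M) (K := |K|) (D := D) hφ hτ hτγ' hτα (by linarith)
    (fun t => norm_nonneg _) ?_
  filter_upwards [hMK] with t ht
  have h1 := ClipVRG.norm_sub_average_le (fun i => x i t ω) i
  have h2 := hD t
  have h3 := norm_sub_le_norm_sub_add_norm_sub (x i t ω)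
    (ClipVRG.average fun i => x i t ω) xstar
  have ht0 : (0 : ℝ) ≤ t := Nat.cast_nonneg t
  have h4 : K * ((ClipVRG.schedule cα φ τα t * ClipVRG.schedule cγ φ τγ t /
      ClipVRG.schedule cη φ τη t) * Real.log ((t : ℝ) + 1)) ≤
      |K| * ((ClipVRG.schedule cα φ τα t * ClipVRG.schedule cγ φ τγ t /
      ClipVRG.schedule cη φ τη t) * Real.log ((t : ℝ) + 2)) := by
    have := (hα t).1
    have := (hγ t).1
    have := (hη t).1
    have hlog : 0 ≤ Real.log ((t : ℝ) + 1) := Real.log_nonneg (by linarith)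
    gcongr
    · exact le_abs_self K
    · norm_num
  linarith
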